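/- For an integer $N\ge 1$ and $\xi\in\mathbb{R}$ let $\lambda_N(\xi)\in[0,\infty]$ be the supremum of the real $\lambda$ such that $$1\le |x|\le X,\qquad \max_{1\le j\le N}|\xi^j x-y_j|\le X^{-\lambda}$$ has a solution $(x,y_1,\dots,y_N)\in\mathbb{Z}^{N+1}$ for arbitrarily large $X$. Let $w_N(\xi)\in[0,\infty]$ (respectively $\widehat{w}_N(\xi)$) be the supremum of the real $w$ such that $$\max_{1\le j\le N}|x_j|\le X,\qquad |x_0+\xi x_1+\cdots+\xi^N x_N|\le X^{-w}$$ has a nonzero solution $(x_0,\dots,x_N)\in\mathbb{Z}^{N+1}$ for arbitrarily large $X$ (respectively for all sufficiently large $X$). Theorem. Let $k\ge n\ge 2$ be integers and let $\xi$ be a transcendental real number. Then $\widehat{w}_n(\xi)$ is finite. If $k\le 2n-2$, then $$\lambda_k(\xi)\ \ge\ \frac{\widehat{w}_n(\xi)+2n-2k-1}{(2n-k-2)\,\widehat{w}_n(\xi)+k}.$$ If $k\le 2n-3$, then moreover $$\lambda_k(\xi)\ \ge\ \min\left\{\Theta,\ \frac{\widehat{w}_n(\xi)+2n-2k-2}{(2n-k-3)\,\widehat{w}_n(\xi)+k}\right\},$$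 where $$\Theta=\frac{w_n(\xi)\widehat{w}_n(\xi)+(n-k-1)w_n(\xi)+(n-k)\widehat{w}_n(\xi)}{(2n-k-2)w_n(\xi)\widehat{w}_n(\xi)+(k-n+1)w_n(\xi)+(n-1)\widehat{w}_n(\xi)},$$ which for $w_n(\xi)=\infty$ is read as its limit $\dfrac{\widehat{w}_n(\xi)+n-k-1}{(2n-k-2)\widehat{w}_n(\xi)+k-n+1}$ as $w_n(\xi)\to\infty$. -/

import Mathlib

open Filter

noncomputable section

/-- The point `(ξ, ξ ^ 2, …, ξ ^ N)` of the Veronese curve. -/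
def veronese (N : ℕ) (ξ : ℝ) : Fin N → ℝ := fun j => ξ ^ ((j : ℕ) + 1)

/-- The system `1 ≤ |x| ≤ X`, `max_j |ξ_j x - y_j| ≤ X ^ (-l)` has an integer solution. -/
def SimSolvable {N : ℕ} (ξ : Fin N → ℝ) (l X : ℝ) : Prop :=
  ∃ (x : ℤ) (y : Fin N → ℤ), 1 ≤ |x| ∧ |(x : ℝ)| ≤ X ∧
    ∀ j, |ξ j * (x : ℝ) - (y j : ℝ)| ≤ X ^ (-l)

/-- The system `max_{1 ≤ j ≤ N} |x_j| ≤ X`, `|x_0 + ξ_1 x_1 + ⋯ + ξ_N x_N| ≤ X ^ (-w)` has a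
nonzero integer solution `(x_0, x)`. -/
def LinSolvable {N : ℕ} (ξ : Fin N → ℝ) (w X : ℝ) : Prop :=
  ∃ (x₀ : ℤ) (x : Fin N → ℤ), (x₀, x) ≠ 0 ∧ (∀ j, |(x j : ℝ)| ≤ X) ∧
    |(x₀ : ℝ) + ∑ j, ξ j * (x j : ℝ)| ≤ X ^ (-w)

/-- The ordinary exponent of simultaneous approximation: the supremum, possibly `⊤`, of the real
`l` such that the system is solvable for arbitrarily large `X`. -/
def simExponent {N : ℕ} (ξ : Fin N → ℝ) : EReal :=
  sSup ((fun l : ℝ => (l : EReal)) '' {l : ℝ | ∃ᶠ X : ℝ in atTop, SimSolvable ξ l X})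

/-- The ordinary exponent of linear form approximation: the supremum, possibly `⊤`, of the real
`w` such that the system is solvable for arbitrarily large `X`. -/
def linExponent {N : ℕ} (ξ : Fin N → ℝ) : EReal :=
  sSup ((fun w : ℝ => (w : EReal)) '' {w : ℝ | ∃ᶠ X : ℝ in atTop, LinSolvable ξ w X})

/-- The uniform exponent of linear form approximation: the supremum of the real `w` such that
the system is solvable for all sufficiently large `X`. -/
def uniformLinExponent {N : ℕ} (ξ : Fin N → ℝ) : EReal :=
  sSup ((fun w : ℝ => (w : EReal)) '' {w : ℝ | ∀ᶠ X : ℝ in atTop, LinSolvable ξ w X})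

/-- The bound `Θ`, as a function of the ordinary exponent `w` and the (finite) uniform exponent
`v` of linear form approximation in dimension `n`. For `w = ⊤` it is the limit of the
expression as `w` tends to infinity. -/
def thetaBound (n k : ℕ) (w : EReal) (v : ℝ) : ℝ :=
  if w = ⊤ then
    (v + ((n : ℝ) - k - 1)) / ((2 * (n : ℝ) - k - 2) * v + ((k : ℝ) - n + 1))
  else
    (w.toReal * v + ((n : ℝ) - k - 1) * w.toReal + ((n : ℝ) - k) * v) /
      ((2 * (n : ℝ) - k - 2) * (w.toReal * v) + ((k : ℝ) - n + 1) * w.toReal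
        + ((n : ℝ) - 1) * v)

end

/-! The proof is a transference argument. An integer polynomial of degree at most `k` that is small
at `ξ` is a small linear form at the Veronese point. Suppose `m` independent forms have heights `h
i` and values at most `h i * ρ`. Minkowski's theorem gives an integer point `(x, y)` orthogonal to
all `m` coefficient vectors with `k - m` of the differences `ξ_j x - y_j` small. Orthogonality and
Cramer's rule then make the other `m` differences small too (`exists_simultaneous_approximation`).
If `∏ h ≪ H ^ γ` and `(∏ h) * ρ ≪ H ^ (-β)`, this yields every exponent below `β / ((k + 1 - m) γ +
(k - m) β)`.

The forms come from an irreducible `P` and a polynomial `Q` not divisible by `P`, both small at `ξ`: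
the shifts `T ^ i * P` and `T ^ i * Q` are independent. Write `v` for the uniform exponent and `r =
k + 1 - n`. If `v ≤ k`, the bounds without `Θ` are at most Dirichlet's `1 / k`. If `v > k`, a
resultant argument gives `deg P > r`, so `r` shifts of each polynomial may be used, and `m = 2 r`
gives the first bound.

For the second bound, if `deg P < n` there is room for one more shift of `P`, and `m = 2 r + 1`
gives the second entry of the minimum. If `deg P = n`, then `Q` is chosen anew so that its value
just beats `|P(ξ)|`. The height of `P` is then about the power `v / w` of that of the search range
for `Q`, where `w` is the ordinary exponent, and the unequal heights give `Θ`. -/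

/-! ### Determinants and Minkowski's theorem on linear forms -/

theorem abs_det_le_factorial_mul {m : ℕ} (A : Matrix (Fin m) (Fin m) ℝ) (h c : Fin m → ℝ)
    (hA : ∀ i j, |A i j| ≤ h i * c j) :
    |A.det| ≤ m.factorial * ((∏ i, h i) * ∏ i, c i) := by
  rw [Matrix.det_apply]
  refine (Finset.abs_sum_le_sum_abs _ _).trans ?_
  have key : ∀ σ ∈ (Finset.univ : Finset (Equiv.Perm (Fin m))),
      |Equiv.Perm.sign σ • ∏ i, A (σ i) i| ≤ (∏ i, h i) * ∏ i, c i := by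
    intro σ _
    have h1 : |Equiv.Perm.sign σ • ∏ i, A (σ i) i| = ∏ i, |A (σ i) i| := by
      rw [← Finset.abs_prod]
      rcases Int.units_eq_one_or (Equiv.Perm.sign σ) with h | h <;> simp [h]
    rw [h1, ← Equiv.prod_comp σ h, ← Finset.prod_mul_distrib]
    exact Finset.prod_le_prod (fun _ _ => abs_nonneg _) (fun i _ => hA _ _)
  refine (Finset.sum_le_sum key).trans ?_
  simp [Fintype.card_perm]

/-- Minkowski's convex body theorem for the preimage of a box, of volume `2 ^ card ι * ∏ c / |det
M|`. The preimage is compact, which is what allows equality in `h`. -/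
theorem exists_int_abs_mulVec_le {ι : Type*} [Fintype ι] [DecidableEq ι] [Nonempty ι]
    (M : Matrix ι ι ℝ) (c : ι → ℝ) (hc : ∀ i, 0 < c i) (hM : M.det ≠ 0)
    (h : |M.det| ≤ ∏ i, c i) :
    ∃ z : ι → ℤ, z ≠ 0 ∧ ∀ i, |(M.mulVec fun j => (z j : ℝ)) i| ≤ c i := by
  classical
  let b := Pi.basisFun ℝ ι
  let s : Set (ι → ℝ) := (Matrix.toLin' M) ⁻¹' (Set.pi Set.univ fun i => Set.Icc (-c i) (c i))
  have hdet : LinearMap.det (Matrix.toLin' M) ≠ 0 := by rwa [LinearMap.det_toLin']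
  have hbox : (MeasureTheory.volume (Set.pi Set.univ fun i => Set.Icc (-c i) (c i)) :
      ENNReal) = ENNReal.ofReal (2 ^ Fintype.card ι * ∏ i, c i) := by
    rw [MeasureTheory.volume_pi, MeasureTheory.Measure.pi_pi]
    simp only [Real.volume_Icc]
    rw [← ENNReal.ofReal_prod_of_nonneg (fun i _ => by linarith [hc i])]
    congr 1
    rw [← Finset.card_univ, ← Finset.prod_const, ← Finset.prod_mul_distrib]
    exact Finset.prod_congr rfl fun i _ => by ring
  have hconv : Convex ℝ s := by
    refine Convex.is_linear_preimage ?_ (Matrix.toLin' M).isLinear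
    exact convex_pi fun i _ => convex_Icc _ _
  have hsymm : ∀ x ∈ s, -x ∈ s := by
    intro x hx
    simp only [s, Set.mem_preimage, Set.mem_pi, Set.mem_univ, true_imp_iff, Set.mem_Icc, map_neg,
      Pi.neg_apply] at hx ⊢
    exact fun i => ⟨by linarith [(hx i).2], by linarith [(hx i).1]⟩
  have hcpt : IsCompact s := by
    have e : s = (LinearEquiv.ofIsUnitDet (f := Matrix.toLin' M)
        (v := b) (v' := b) (by
          rw [LinearMap.det_toMatrix]; exact hdet.isUnit)).toContinuousLinearEquiv.toHomeomorph ⁻¹'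
        (Set.pi Set.univ fun i => Set.Icc (-c i) (c i)) := rfl
    rw [e, Homeomorph.isCompact_preimage]
    exact isCompact_univ_pi fun i => isCompact_Icc
  have hfund := ZSpan.isAddFundamentalDomain' b MeasureTheory.volume
  have : DiscreteTopology (Submodule.span ℤ (Set.range b)).toAddSubgroup :=
    inferInstanceAs (DiscreteTopology (Submodule.span ℤ (Set.range b)))
  have : Countable (Submodule.span ℤ (Set.range b)).toAddSubgroup :=
    inferInstanceAs (Countable (Submodule.span ℤ (Set.range b)))
  obtain ⟨x, hx0, hxs⟩ :=
    MeasureTheory.exists_ne_zero_mem_lattice_of_measure_mul_two_pow_le_measure hfund hsymm hconv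
      hcpt (by
        rw [MeasureTheory.Measure.addHaar_preimage_linearMap _ hdet, hbox, LinearMap.det_toLin',
          ← ENNReal.ofReal_mul (abs_nonneg _)]
        have : (MeasureTheory.volume (ZSpan.fundamentalDomain b)) = 1 := by
          simp [b, ZSpan.fundamentalDomain_pi_basisFun, MeasureTheory.volume_pi,
            MeasureTheory.Measure.pi_pi]
        rw [this, one_mul]
        have h2 : ((2 : ENNReal) ^ Module.finrank ℝ (ι → ℝ)) =
            ENNReal.ofReal (2 ^ Fintype.card ι) := by
          rw [ENNReal.ofReal_pow (by norm_num)]; simp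
        rw [h2]
        apply ENNReal.ofReal_le_ofReal
        have hpos : 0 < |M.det| := abs_pos.2 hM
        rw [abs_inv, mul_left_comm]
        refine le_mul_of_one_le_right (by positivity) ?_
        rw [inv_mul_eq_div, le_div_iff₀ hpos, one_mul]
        exact h)
  have hmem : ∀ i, ∃ z : ℤ, (z : ℝ) = (x : ι → ℝ) i := by
    intro i
    obtain ⟨z, hz⟩ := (b.mem_span_iff_repr_mem ℤ (x : ι → ℝ)).1 x.2 i
    exact ⟨z, by simpa [b] using hz⟩
  choose z hz using hmem
  refine ⟨z, ?_, ?_⟩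
  · rintro rfl
    apply hx0
    ext i
    simp [← hz]
  · intro i
    have e : (fun j => (z j : ℝ)) = (x : ι → ℝ) := funext hz
    rw [e, abs_le]
    have := hxs i (Set.mem_univ i)
    simpa using this

theorem exists_submatrix_det_ne_zero {K ι : Type*} [Field K] [Finite ι] {m : ℕ}
    (b : Matrix (Fin m) ι K) (hb : LinearIndependent K b.row) :
    ∃ g : Fin m → ι, (b.submatrix id g).det ≠ 0 := by
  classical
  cases nonempty_fintype ι
  have hrank : b.rank = m := by simpa using LinearIndependent.rank_matrix (M := b) hb
  obtain ⟨κ, a, ha, hspan, hli⟩ := exists_linearIndependent' K b.col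
  have : Finite κ := Finite.of_injective a ha
  cases nonempty_fintype κ
  have hcard : Fintype.card κ = m := by
    rw [Matrix.rank_eq_finrank_span_cols, ← hspan, finrank_span_eq_card hli] at hrank
    exact hrank
  let e : Fin m ≃ κ := (Fintype.equivFinOfCardEq hcard).symm
  refine ⟨a ∘ e, ?_⟩
  have : LinearIndependent K (b.submatrix id (a ∘ e)).col := hli.comp e e.injective
  rw [Matrix.linearIndependent_cols_iff_isUnit, Matrix.isUnit_iff_isUnit_det] at this
  exact this.ne_zero

/-! ### From independent linear forms to simultaneous approximation -/

/-- Independence gives a nonzero minor of the matrix extended by the column `a₀`. If all minors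
avoiding `a₀` vanished, replacing `a₀` by the column of values would not change this minor, so `hρ`
would make a nonzero integer less than 1 in absolute value. -/
theorem exists_maximal_minor {m k : ℕ} (a₀ : Fin m → ℤ) (a : Matrix (Fin m) (Fin k) ℤ)
    (ξ : Fin k → ℝ) (h : Fin m → ℝ) (ρ : ℝ)
    (hlin : ∀ c : Fin m → ℤ, ∑ i, c i * a₀ i = 0 → (∀ j, ∑ i, c i * a i j = 0) → c = 0)
    (ha : ∀ i j, |(a i j : ℝ)| ≤ h i)
    (hv : ∀ i, |(a₀ i : ℝ) + ∑ j, ξ j * (a i j : ℝ)| ≤ h i * ρ)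
    (hρ : m.factorial * ((∏ i, h i) * ρ) < 1) :
    ∃ f : Fin m → Fin k,
      (∀ g : Fin m → Fin k, |((a.map (Int.cast : ℤ → ℝ)).submatrix id g).det| ≤
        |((a.map (Int.cast : ℤ → ℝ)).submatrix id f).det|) ∧
      1 ≤ |((a.map (Int.cast : ℤ → ℝ)).submatrix id f).det| := by
  classical
  have hcast : ∀ g : Fin m → Fin k, ((a.map (Int.cast : ℤ → ℝ)).submatrix id g).det =
      ((a.submatrix id g).det : ℝ) := fun g => by
    rw [Int.cast_det]; rfl
  suffices H : ∃ f : Fin m → Fin k, (a.submatrix id f).det ≠ 0 by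
    obtain ⟨f₀, hf₀⟩ := H
    have : Nonempty (Fin m → Fin k) := ⟨f₀⟩
    obtain ⟨f, hf⟩ := Finite.exists_max fun g : Fin m → Fin k =>
      |((a.map (Int.cast : ℤ → ℝ)).submatrix id g).det|
    refine ⟨f, hf, le_trans ?_ (hf f₀)⟩
    rw [hcast]
    exact_mod_cast Int.one_le_abs hf₀
  by_contra! hzero
  let b : Matrix (Fin m) (Option (Fin k)) ℤ := Matrix.of fun i o => o.elim (a₀ i) (a i)
  have hb : LinearIndependent ℚ (b.map (Int.cast : ℤ → ℚ)).row := by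
    rw [← LinearIndependent.iff_fractionRing ℤ ℚ, Fintype.linearIndependent_iff]
    intro c hc
    have hc' : ∀ o, ∑ i, c i * b i o = 0 := by
      intro o
      have h1 := congrFun hc o
      rw [Finset.sum_apply] at h1
      have h2 : ∑ i, (c i : ℚ) * (b i o : ℚ) = 0 := by
        refine Eq.trans (Finset.sum_congr rfl fun i _ => ?_) h1
        exact (zsmul_eq_mul (b i o : ℚ) (c i)).symm
      exact_mod_cast h2
    have := hlin c (hc' none) fun j => hc' (some j)
    exact fun i => congrFun this i
  obtain ⟨g, hg⟩ := exists_submatrix_det_ne_zero _ hb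
  have hgZ : (b.submatrix id g).det ≠ 0 := by
    intro h0
    apply hg
    have : ((b.map (Int.cast : ℤ → ℚ)).submatrix id g).det = ((b.submatrix id g).det : ℚ) := by
      rw [Int.cast_det]; rfl
    rw [this, h0, Int.cast_zero]
  have hginj : Function.Injective g := by
    intro i j hij
    by_contra hne
    exact hgZ (Matrix.det_zero_of_column_eq hne fun r => by simp [hij])
  have hsome : ∀ g' : Fin m → Option (Fin k), (∀ i, g' i ≠ none) →
      (b.submatrix id g').det = 0 := by
    intro g' hg'
    choose f hf using fun i => Option.ne_none_iff_exists'.1 (hg' i)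
    rw [← hzero f]
    congr 1
    ext i j
    simp [b, hf]
  by_cases hnone : ∀ i, g i ≠ none
  · exact hgZ (hsome g hnone)
  push Not at hnone
  obtain ⟨j, hj⟩ := hnone
  have hne : ∀ i, i ≠ j → g i ≠ none := fun i hi h => hi (hginj (h.trans hj.symm))
  set A : Matrix (Fin m) (Fin m) ℝ := (b.map (Int.cast : ℤ → ℝ)).submatrix id g with hA
  have hAdet : A.det = ((b.submatrix id g).det : ℝ) := by rw [Int.cast_det]; rfl
  let v : Fin m → ℝ := fun i => (a₀ i : ℝ) + ∑ j, ξ j * (a i j : ℝ)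
  have hupd : ∀ c : Fin k, A.cramer (fun i => (a i c : ℝ)) j = 0 := by
    intro c
    rw [Matrix.cramer_apply]
    have h0 := hsome (Function.update g j (some c)) fun i => by
      by_cases hi : i = j
      · subst hi; simp
      · simpa [hi] using hne i hi
    have : A.updateCol j (fun i => (a i c : ℝ)) =
        (b.submatrix id (Function.update g j (some c))).map (Int.cast : ℤ → ℝ) := by
      ext i i'
      by_cases hi : i' = j
      · subst hi; simp [b]
      · simp [hi, hA]
    rw [this]
    have e := Int.cast_det (R := ℝ) (b.submatrix id (Function.update g j (some c)))
    rw [h0, Int.cast_zero] at e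
    exact e.symm
  -- The column `a₀` is the value column minus a combination of the columns of `a`; by `hupd` that
  -- combination contributes nothing to the determinant.
  have hcol : (fun i => A i j) = v - ∑ c, ξ c • fun i => (a i c : ℝ) := by
    ext i
    simp [hA, hj, b, v]
  have h1 : A.det = A.cramer v j := by
    have : A.cramer (fun i => A i j) j = A.det := by
      rw [Matrix.cramer_apply]
      congr 1
      ext i i'
      by_cases hi : i' = j
      · subst hi; simp
      · simp [hi]
    rw [← this, hcol, map_sub, map_sum]
    simp [hupd]
  have h2 : |A.cramer v j| ≤ m.factorial * ((∏ i, h i) * ρ) := by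
    rw [Matrix.cramer_apply]
    refine (abs_det_le_factorial_mul _ h (Function.update 1 j ρ) ?_).trans_eq ?_
    · intro i i'
      by_cases hi : i' = j
      · subst hi; simpa using hv i
      · obtain ⟨c, hc⟩ := Option.ne_none_iff_exists'.1 (hne i' hi)
        simpa [hi, hA, hc, b] using ha i c
    · rw [Finset.prod_update_of_mem (Finset.mem_univ _)]
      simp
  have h3 : (1 : ℝ) ≤ |A.det| := by
    rw [hAdet]
    exact_mod_cast Int.one_le_abs hgZ
  rw [h1] at h3
  linarith

/-- The maximal minor serves twice: its size is the determinant in Minkowski's theorem, and its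
maximality bounds the quotients in Cramer's rule by 1. The inequality `m ≤ k` stands apart because
its failure is the contradiction in the resultant argument. -/
theorem exists_simultaneous_approximation {m k : ℕ} (a₀ : Fin m → ℤ)
    (a : Matrix (Fin m) (Fin k) ℤ)
    (ξ : Fin k → ℝ) (h : Fin m → ℝ) (ρ Y : ℝ)
    (hlin : ∀ c : Fin m → ℤ, ∑ i, c i * a₀ i = 0 → (∀ j, ∑ i, c i * a i j = 0) → c = 0)
    (ha : ∀ i j, |(a i j : ℝ)| ≤ h i)
    (hv : ∀ i, |(a₀ i : ℝ) + ∑ j, ξ j * (a i j : ℝ)| ≤ h i * ρ)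
    (hρ : m.factorial * ((∏ i, h i) * ρ) < 1) :
    m ≤ k ∧ (0 < Y → m.factorial * ((∏ i, h i) * ρ) ≤ Y ^ (k + 1 - m) →
    ∃ (x : ℤ) (y : Fin k → ℤ), (x, y) ≠ 0 ∧
      |(x : ℝ)| ≤ 2 ^ m * (m.factorial * ∏ i, h i) / Y ^ (k - m) ∧
      ∀ j, |ξ j * x - y j| ≤ (2 ^ m + k) * Y) := by
  classical
  obtain ⟨f, hmax, hone⟩ := exists_maximal_minor a₀ a ξ h ρ hlin ha hv hρ
  set aR : Matrix (Fin m) (Fin k) ℝ := a.map (Int.cast : ℤ → ℝ) with haR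
  set A : Matrix (Fin m) (Fin m) ℝ := aR.submatrix id f with hA
  have hΔ : 0 < |A.det| := by linarith
  have hA0 : A.det ≠ 0 := abs_pos.1 hΔ
  have hinj : Function.Injective f := by
    intro i j hij
    by_contra hne
    exact hA0 (Matrix.det_zero_of_column_eq hne fun r => by simp [hA, hij])
  have hmk : m ≤ k := by simpa using Fintype.card_le_of_injective f hinj
  refine ⟨hmk, fun hY hYm => ?_⟩
  let v : Fin m → ℝ := fun i => (a₀ i : ℝ) + ∑ j, ξ j * (a i j : ℝ)
  have hΔle : |A.det| ≤ m.factorial * ∏ i, h i := by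
    refine (abs_det_le_factorial_mul A h 1 fun i j => ?_).trans_eq (by simp)
    simpa [hA, haR] using ha i (f j)
  have hcv : ∀ j, |A.cramer v j| ≤ m.factorial * ((∏ i, h i) * ρ) := by
    intro j
    rw [Matrix.cramer_apply]
    refine (abs_det_le_factorial_mul _ h (Function.update 1 j ρ) ?_).trans_eq ?_
    · intro i i'
      by_cases hi : i' = j
      · subst hi; simpa using hv i
      · simpa [hi, hA, haR] using ha i (f i')
    · rw [Finset.prod_update_of_mem (Finset.mem_univ _)]
      simp
  have hca : ∀ j c, |A.cramer (fun i => aR i c) j| ≤ |A.det| := by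
    intro j c
    refine le_of_eq_of_le ?_ (hmax (Function.update f j c))
    rw [Matrix.cramer_apply]
    congr 2
    ext i i'
    by_cases hi : i' = j
    · subst hi; simp
    · simp [hi, hA]
  -- The rows indexed by the range of `f` express orthogonality to the `m` integer vectors in the
  -- coordinates `(x, ξ_c x - y_c)`; the other rows are those of the identity.
  let N : Matrix (Option (Fin k)) (Option (Fin k)) ℝ := Matrix.of fun o o' =>
    o.elim (if o' = none then 1 else 0) fun c =>
      if hc : ∃ j, f j = c then o'.elim (-v hc.choose) (aR hc.choose)
      else if o' = some c then 1 else 0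
  have hNf : ∀ j o', N (some (f j)) o' = o'.elim (-v j) (aR j) := by
    intro j o'
    have hc : ∃ j', f j' = f j := ⟨j, rfl⟩
    have e : hc.choose = j := hinj hc.choose_spec
    simp only [N, Matrix.of_apply, Option.elim_some, dif_pos hc, e]
  have hNc : ∀ c, (∀ j, f j ≠ c) → ∀ o', N (some c) o' = if o' = some c then 1 else 0 := by
    intro c hc o'
    have hc' : ¬ ∃ j, f j = c := by simpa using hc
    simp only [N, Matrix.of_apply, Option.elim_some, dif_neg hc']
  have hN0 : ∀ o', N none o' = if o' = none then 1 else 0 := fun o' => rfl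
  -- The involution `(x, y) ↦ (x, ξ x - y)`.
  let U : Matrix (Option (Fin k)) (Option (Fin k)) ℝ := Matrix.of fun o o' =>
    o.elim (if o' = none then 1 else 0) fun c =>
      o'.elim (ξ c) fun c' => if c = c' then -1 else 0
  have hUU : U * U = 1 := by
    ext o o'
    rw [Matrix.mul_apply, Fintype.sum_option]
    rcases o with _ | c <;> rcases o' with _ | c' <;> simp [U, Matrix.one_apply]
    split_ifs <;> simp
  have hUdet : |U.det| = 1 := by
    have : U.det * U.det = 1 := by rw [← Matrix.det_mul, hUU, Matrix.det_one]
    have h1 : |U.det| * |U.det| = 1 := by rw [← abs_mul, this, abs_one]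
    nlinarith [abs_nonneg U.det]
  have hNdet : N.det = A.det := by
    let p : Option (Fin k) → Prop := fun o => ∃ j, some (f j) = o
    have hnp : ∀ o, ¬ p o → ∀ o', N o o' = if o' = o then 1 else 0 := by
      intro o ho o'
      rcases o with _ | c
      · exact hN0 o'
      · exact hNc c (fun j hj => ho ⟨j, by rw [hj]⟩) o'
    rw [Matrix.twoBlockTriangular_det N p]
    · let e : Fin m ≃ {o // p o} := Equiv.ofBijective (fun j => ⟨some (f j), j, rfl⟩)
        ⟨fun i j hij => hinj (by simpa using hij), fun ⟨o, j, hj⟩ => ⟨j, Subtype.ext hj⟩⟩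
      have h1 : (N.toSquareBlockProp p).det = A.det := by
        rw [← Matrix.det_submatrix_equiv_self e]
        congr 1
        ext i j
        exact hNf i (some (f j))
      have h2 : (N.toSquareBlockProp fun i => ¬ p i) = 1 := by
        ext i j
        rw [Matrix.toSquareBlockProp_def, Matrix.of_apply, hnp i i.2, Matrix.one_apply]
        simp [Subtype.ext_iff, eq_comm]
      rw [h1, h2, Matrix.det_one, mul_one]
    · intro o ho o' ho'
      rw [hnp o ho, if_neg]
      rintro rfl
      exact ho ho'
  -- Chosen so that the box has `∏ c = |det A|`, with side `1 / 2` for each of the `m` orthogonality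
  -- conditions.
  set X : ℝ := 2 ^ m * |A.det| / Y ^ (k - m) with hX
  have hXpos : 0 < X := by positivity
  let c : Option (Fin k) → ℝ := fun o => o.elim X fun c => if ∃ j, f j = c then 1 / 2 else Y
  have hc : ∀ o, 0 < c o := by
    rintro (_ | o)
    · exact hXpos
    · simp only [c, Option.elim_some]
      split_ifs <;> positivity
  have himg : (Finset.univ.filter fun c => ∃ j, f j = c) = Finset.univ.image f := by
    ext; simp
  have hcprod : ∏ o, c o = |A.det| := by
    rw [Fintype.prod_option]
    simp only [c, Option.elim_some, Option.elim_none]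
    rw [Finset.prod_ite, Finset.prod_const, Finset.prod_const, Finset.filter_not, himg,
      Finset.card_sdiff_of_subset (Finset.subset_univ _), Finset.card_image_of_injective _ hinj]
    simp only [Finset.card_univ, Fintype.card_fin, hX]
    field_simp
    rw [← mul_pow]; norm_num
  have hMdet : |(N * U).det| = |A.det| := by
    rw [Matrix.det_mul, abs_mul, hUdet, mul_one, hNdet]
  obtain ⟨z, hz0, hz⟩ := exists_int_abs_mulVec_le (N * U) c hc
    (abs_pos.1 (by rw [hMdet]; exact hΔ)) (by rw [hMdet, hcprod])
  set u : Option (Fin k) → ℝ := U.mulVec fun o => (z o : ℝ) with hu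
  have hMu : (N * U).mulVec (fun o => (z o : ℝ)) = N.mulVec u := by
    rw [hu, Matrix.mulVec_mulVec]
  rw [hMu] at hz
  have hu0 : u none = z none := by
    simp [hu, Matrix.mulVec, dotProduct, U]
  have hus : ∀ c, u (some c) = ξ c * z none - z (some c) := by
    intro c
    simp only [hu, Matrix.mulVec, dotProduct, U, Fintype.sum_option, Matrix.of_apply,
      Option.elim_some, Option.elim_none]
    simp [sub_eq_add_neg]
  have hx : |(z none : ℝ)| ≤ X := by
    have := hz none
    simpa [Matrix.mulVec, dotProduct, hN0, hu0, c] using this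
  have hrow : ∀ j, N.mulVec u (some (f j)) = -v j * z none + ∑ c, aR j c * u (some c) := by
    intro j
    simp [Matrix.mulVec, dotProduct, hNf, Fintype.sum_option, hu0]
  -- Up to sign, the row evaluates to the integer `a₀ j * x + ∑ a j c * y c`; being at most `1 / 2`
  -- in absolute value, it is zero.
  have hortho : ∀ j, ∑ c, aR j c * u (some c) = z none * v j := by
    intro j
    have h1 := hz (some (f j))
    rw [hrow] at h1
    have h2 : -v j * z none + ∑ c, aR j c * u (some c) =
        ((-(a₀ j * z none + ∑ c, a j c * z (some c)) : ℤ) : ℝ) := by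
      push_cast
      simp only [v, hus, haR, Matrix.map_apply, mul_sub, Finset.sum_sub_distrib, neg_mul, add_mul,
        Finset.sum_mul]
      have : ∑ x, (a j x : ℝ) * (ξ x * (z none : ℝ)) = ∑ x, ξ x * (a j x : ℝ) * (z none : ℝ) :=
        Finset.sum_congr rfl fun _ _ => by ring
      rw [this]; ring
    have h3 : c (some (f j)) = 1 / 2 := by simp [c]
    rw [h2, h3] at h1
    have h4 : |(-(a₀ j * z none + ∑ c, a j c * z (some c)) : ℤ)| < 1 := by
      have : ((|(-(a₀ j * z none + ∑ c, a j c * z (some c)) : ℤ)| : ℤ) : ℝ) < 1 := by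
        rw [Int.cast_abs]; linarith
      exact_mod_cast this
    rw [Int.abs_lt_one_iff] at h4
    rw [h4, Int.cast_zero] at h2
    linarith
  have hoff : ∀ c', (∀ j, f j ≠ c') → |u (some c')| ≤ Y := by
    intro c' hc'
    have h1 := hz (some c')
    have h2 : c (some c') = Y := by simp [c, hc']
    rw [h2] at h1
    simpa [Matrix.mulVec, dotProduct, hNc c' hc'] using h1
  have hXY : m.factorial * ((∏ i, h i) * ρ) * X ≤ |A.det| * (2 ^ m * Y) := by
    rw [hX, show k + 1 - m = (k - m) + 1 by omega, pow_succ] at *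
    rw [← mul_div_assoc, div_le_iff₀ (by positivity)]
    calc _ ≤ Y ^ (k - m) * Y * (2 ^ m * |A.det|) := by gcongr
      _ = _ := by ring
  -- Cramer's rule for the coordinates in the range of `f`: `hXY` bounds the term in `x` by `2 ^ m *
  -- Y`, and each of the at most `k` remaining terms is at most `Y` by maximality of the minor.
  have hon : ∀ j, |u (some (f j))| ≤ (2 ^ m + k) * Y := by
    intro j
    let S := (Finset.univ.image f)ᶜ
    have hS : ∀ c ∈ S, |u (some c)| ≤ Y := by
      intro c hc
      refine hoff c fun j hj => ?_
      simp only [S, Finset.mem_compl, Finset.mem_image, not_exists] at hc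
      exact hc j ⟨Finset.mem_univ _, hj⟩
    have hAu : A.mulVec (fun j => u (some (f j))) =
        (z none : ℝ) • v - ∑ c ∈ S, u (some c) • fun i => aR i c := by
      ext i
      have h1 := hortho i
      rw [← Finset.sum_add_sum_compl (Finset.univ.image f), Finset.sum_image hinj.injOn] at h1
      have h2 : A.mulVec (fun j => u (some (f j))) i = ∑ x, aR i (f x) * u (some (f x)) := by
        simp [Matrix.mulVec, dotProduct, hA]
      rw [h2, Pi.sub_apply, Pi.smul_apply, smul_eq_mul, ← h1, Finset.sum_apply]
      simp only [Pi.smul_apply, smul_eq_mul, S]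
      rw [eq_sub_iff_add_eq]
      congr 1
      exact Finset.sum_congr rfl fun _ _ => mul_comm _ _
    have hcr : A.det * u (some (f j)) = z none * A.cramer v j -
        ∑ c ∈ S, u (some c) * A.cramer (fun i => aR i c) j := by
      have h1 := congrArg (fun w => A.cramer w j) hAu
      simp only [map_sub, map_smul, map_sum, Pi.sub_apply, Pi.smul_apply, smul_eq_mul,
        Finset.sum_apply] at h1
      rw [← h1, Matrix.cramer_eq_adjugate_mulVec, Matrix.mulVec_mulVec, Matrix.adjugate_mul]
      simp [Matrix.smul_mulVec]
    have hsum : |∑ c ∈ S, u (some c) * A.cramer (fun i => aR i c) j| ≤ k * (Y * |A.det|) := by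
      refine (Finset.abs_sum_le_sum_abs _ _).trans ?_
      refine (Finset.sum_le_card_nsmul S _ (Y * |A.det|) fun c hc => ?_).trans ?_
      · rw [abs_mul]
        exact mul_le_mul (hS c hc) (hca j c) (abs_nonneg _) hY.le
      · rw [nsmul_eq_mul]
        have : (S.card : ℝ) ≤ k := by
          exact_mod_cast (Finset.card_le_univ S).trans_eq (Fintype.card_fin k)
        gcongr
    have hfirst : |(z none : ℝ) * A.cramer v j| ≤ |A.det| * (2 ^ m * Y) := by
      refine le_trans ?_ hXY
      rw [abs_mul, mul_comm]
      exact mul_le_mul (hcv j) hx (abs_nonneg _) ((abs_nonneg _).trans (hcv j))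
    have : |A.det| * |u (some (f j))| ≤ |A.det| * ((2 ^ m + k) * Y) := by
      rw [← abs_mul, hcr]
      refine (abs_sub _ _).trans ?_
      linarith
    exact le_of_mul_le_mul_left this hΔ
  refine ⟨z none, fun c => z (some c), ?_, ?_, ?_⟩
  · intro h0
    apply hz0
    rw [Prod.mk_eq_zero] at h0
    ext o
    rcases o with _ | o
    · exact h0.1
    · exact congrFun h0.2 o
  · refine hx.trans ?_
    rw [hX]
    gcongr
  · intro j
    rw [← hus]
    by_cases hj : ∃ i, f i = j
    · obtain ⟨i, rfl⟩ := hj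
      exact hon i
    · push Not at hj
      refine (hoff j hj).trans ?_
      have : (1 : ℝ) ≤ 2 ^ m := one_le_pow₀ (by norm_num)
      have : (0 : ℝ) ≤ k := Nat.cast_nonneg k
      nlinarith

/-- The least admissible `Y` is of order `H ^ (-β / s)` with `s = k + 1 - m`; then `x` is of order
at most `H ^ κ`, and the attainable exponents are those below `(β / s) / κ`. -/
theorem eventually_simSolvable_of_system {k m : ℕ} (ξ : Fin k → ℝ) (C β γ l : ℝ) (hC : 0 < C)
    (hβ : 0 < β) (hmk : m ≤ k) (hpos : 0 < ((k : ℝ) + 1 - m) * γ + ((k : ℝ) - m) * β)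
    (hl : l * (((k : ℝ) + 1 - m) * γ + ((k : ℝ) - m) * β) < β) (B : ℝ) :
    ∀ᶠ H : ℝ in atTop, ∀ (a₀ : Fin m → ℤ) (a : Matrix (Fin m) (Fin k) ℤ) (h : Fin m → ℝ) (ρ : ℝ),
      (∀ c : Fin m → ℤ, ∑ i, c i * a₀ i = 0 → (∀ j, ∑ i, c i * a i j = 0) → c = 0) →
      (∀ i j, |(a i j : ℝ)| ≤ h i) →
      (∀ i, |(a₀ i : ℝ) + ∑ j, ξ j * (a i j : ℝ)| ≤ h i * ρ) →
      ∏ i, h i ≤ C * H ^ γ → (∏ i, h i) * ρ ≤ C * H ^ (-β) →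
      ∃ X ≥ B, SimSolvable ξ l X := by
  have hmk' : (m : ℝ) ≤ k := by exact_mod_cast hmk
  set s : ℝ := (k : ℝ) + 1 - m with hs
  have hs0 : 0 < s := by linarith
  set κ : ℝ := γ + ((k : ℝ) - m) * (β / s) with hκ
  have hκs : s * κ = s * γ + ((k : ℝ) - m) * β := by rw [hκ]; field_simp
  have hκ0 : 0 < κ := by
    rw [← hκs] at hpos
    exact pos_of_mul_pos_right hpos hs0.le
  have hlκ : l * κ < β / s := by
    rw [lt_div_iff₀ hs0]
    rw [← hκs] at hl
    linarith
  set C₁ : ℝ := m.factorial * C with hC₁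
  have hC₁0 : 0 < C₁ := by positivity
  set K₁ : ℝ := C₁ ^ (1 / s) with hK₁
  have hK₁0 : 0 < K₁ := by positivity
  set K₂ : ℝ := 2 ^ m * C₁ / K₁ ^ (k - m) with hK₂
  have hK₂0 : 0 < K₂ := by positivity
  set D : ℝ := 2 ^ m + k with hD
  have hD0 : 0 < D := by positivity
  have e1 : Tendsto (fun H : ℝ => C₁ * H ^ (-β)) atTop (nhds 0) := by
    simpa using (tendsto_rpow_neg_atTop hβ).const_mul C₁
  have e2 : Tendsto (fun H : ℝ => D * K₁ * H ^ (-(β / s))) atTop (nhds 0) := by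
    simpa using (tendsto_rpow_neg_atTop (div_pos hβ hs0)).const_mul (D * K₁)
  have e3 : Tendsto (fun H : ℝ => K₂ * H ^ κ) atTop atTop :=
    (tendsto_rpow_atTop hκ0).const_mul_atTop hK₂0
  have e4 : Tendsto (fun H : ℝ => H ^ (β / s - l * κ)) atTop atTop :=
    tendsto_rpow_atTop (by linarith)
  filter_upwards [e1.eventually_lt_const one_pos, e2.eventually_lt_const one_pos,
    e3.eventually_ge_atTop B, e4.eventually_ge_atTop (D * K₁ * K₂ ^ l), eventually_gt_atTop 0]
    with H h1 h2 h3 h4 hH a₀ a h ρ hlin ha hv hγ hρ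
  have hsN : ((k + 1 - m : ℕ) : ℝ) = s := by
    rw [Nat.cast_sub (by omega)]; push_cast; rfl
  have hkm : ((k - m : ℕ) : ℝ) = (k : ℝ) - m := Nat.cast_sub hmk
  set Y : ℝ := K₁ * H ^ (-(β / s)) with hY
  have hY0 : 0 < Y := by positivity
  have hYs : Y ^ (k + 1 - m) = C₁ * H ^ (-β) := by
    rw [hY, mul_pow, hK₁, ← Real.rpow_natCast, ← Real.rpow_mul hC₁0.le, hsN,
      ← Real.rpow_natCast (H ^ _), ← Real.rpow_mul hH.le, hsN]
    congr 2
    · rw [one_div_mul_cancel hs0.ne', Real.rpow_one]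
    · field_simp
  have hρ' : m.factorial * ((∏ i, h i) * ρ) ≤ C₁ * H ^ (-β) := by
    rw [hC₁, mul_assoc]
    exact mul_le_mul_of_nonneg_left hρ (Nat.cast_nonneg _)
  obtain ⟨x, y, hxy, hx, hy⟩ := (exists_simultaneous_approximation a₀ a ξ h ρ Y hlin ha hv
    (hρ'.trans_lt h1)).2 hY0 (hρ'.trans_eq hYs.symm)
  have hDY : D * Y = D * K₁ * H ^ (-(β / s)) := by rw [hY]; ring
  refine ⟨K₂ * H ^ κ, h3, x, y, ?_, ?_, fun j => ?_⟩
  -- If `x = 0`, every `|y j|` is less than 1, so the whole point vanishes.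
  · refine Int.one_le_abs fun hx0 => hxy ?_
    rw [Prod.mk_eq_zero]
    refine ⟨hx0, funext fun j => ?_⟩
    have h5 := hy j
    rw [hx0] at h5
    have h6 : ((|y j| : ℤ) : ℝ) < 1 := by
      rw [Int.cast_abs]
      have : |(y j : ℝ)| ≤ D * Y := by simpa using h5
      linarith
    exact Int.abs_lt_one_iff.1 (by exact_mod_cast h6)
  · refine hx.trans ?_
    have h5 : Y ^ (k - m) = K₁ ^ (k - m) * H ^ (-(((k : ℝ) - m) * (β / s))) := by
      rw [hY, mul_pow, ← Real.rpow_natCast (H ^ _), ← Real.rpow_mul hH.le, hkm]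
      congr 2; ring
    rw [div_le_iff₀ (by positivity), h5, hK₂]
    calc 2 ^ m * (m.factorial * ∏ i, h i) ≤ 2 ^ m * (m.factorial * (C * H ^ γ)) := by gcongr
      _ = 2 ^ m * C₁ * (H ^ κ * H ^ (-(((k : ℝ) - m) * (β / s)))) := by
        rw [← Real.rpow_add hH, hκ, hC₁]; ring_nf
      _ = _ := by field_simp
  · refine (hy j).trans ?_
    rw [Real.mul_rpow hK₂0.le (by positivity), ← Real.rpow_mul hH.le, Real.rpow_neg hK₂0.le,
      ← div_eq_inv_mul, le_div_iff₀ (by positivity)]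
    calc D * Y * K₂ ^ l = D * K₁ * K₂ ^ l * H ^ (-(β / s)) := by rw [hDY]; ring
      _ ≤ H ^ (β / s - l * κ) * H ^ (-(β / s)) := by gcongr
      _ = _ := by rw [← Real.rpow_add hH]; congr 1; ring

/-! ### Integer polynomials and the Mahler measure -/

open Polynomial in
theorem aeval_eq_coeff_zero_add_sum_veronese {k : ℕ} (ξ : ℝ) {P : ℤ[X]} (hP : P.natDegree ≤ k) :
    aeval ξ P = (P.coeff 0 : ℝ) + ∑ j : Fin k, veronese k ξ j * (P.coeff (j + 1) : ℝ) := by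
  rw [aeval_eq_sum_range' (Nat.lt_succ_of_le hP), Finset.sum_range_succ', add_comm,
    Finset.sum_range]
  simp [veronese, mul_comm]

/-- The Mahler measure of an integer polynomial. -/
noncomputable def intMahler (P : Polynomial ℤ) : ℝ := (P.map (Int.castRingHom ℂ)).mahlerMeasure

theorem intMahler_nonneg (P : Polynomial ℤ) : 0 ≤ intMahler P :=
  Polynomial.mahlerMeasure_nonneg _

theorem one_le_intMahler {P : Polynomial ℤ} (hP : P ≠ 0) : 1 ≤ intMahler P :=
  Polynomial.one_le_mahlerMeasure_of_ne_zero hP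

theorem intMahler_mul (P Q : Polynomial ℤ) : intMahler (P * Q) = intMahler P * intMahler Q := by
  simp [intMahler, Polynomial.mahlerMeasure_mul]

theorem intMahler_le_of_dvd {P Q : Polynomial ℤ} (hQ : Q ≠ 0) (h : P ∣ Q) :
    intMahler P ≤ intMahler Q := by
  obtain ⟨R, rfl⟩ := h
  rw [intMahler_mul]
  exact le_mul_of_one_le_right (Polynomial.mahlerMeasure_nonneg _)
    (one_le_intMahler (right_ne_zero_of_mul hQ))

theorem abs_coeff_le_intMahler {n : ℕ} {P : Polynomial ℤ} (hP : P.natDegree ≤ n) (i : ℕ) :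
    |(P.coeff i : ℝ)| ≤ 2 ^ n * intMahler P := by
  have h := Polynomial.norm_coeff_le_choose_mul_mahlerMeasure i (P.map (Int.castRingHom ℂ))
  have h1 : ‖(P.map (Int.castRingHom ℂ)).coeff i‖ = |(P.coeff i : ℝ)| := by simp
  rw [h1] at h
  refine h.trans ?_
  refine mul_le_mul_of_nonneg_right ?_ (Polynomial.mahlerMeasure_nonneg _)
  have h2 : (P.map (Int.castRingHom ℂ)).natDegree ≤ n := Polynomial.natDegree_map_le.trans hP
  calc (((P.map (Int.castRingHom ℂ)).natDegree.choose i : ℕ) : ℝ)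
      ≤ 2 ^ (P.map (Int.castRingHom ℂ)).natDegree := by exact_mod_cast Nat.choose_le_two_pow _ _
    _ ≤ 2 ^ n := pow_le_pow_right₀ (by norm_num) h2

theorem intMahler_le {n : ℕ} {P : Polynomial ℤ} (hP : P.natDegree ≤ n) {h : ℝ}
    (hc : ∀ i, |(P.coeff i : ℝ)| ≤ h) : intMahler P ≤ (n + 1) * h := by
  refine (Polynomial.mahlerMeasure_le_sum_norm_coeff _).trans ?_
  rw [Polynomial.sum_over_range' _ (by simp) (n + 1)
    (Nat.lt_succ_of_le (Polynomial.natDegree_map_le.trans hP))]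
  refine (Finset.sum_le_card_nsmul _ _ h fun i _ => ?_).trans_eq (by simp)
  simpa using hc i

theorem finite_intMahler_lt (n : ℕ) (B : ℝ) :
    {P : Polynomial ℤ | P.natDegree ≤ n ∧ intMahler P < B}.Finite := by
  refine (Polynomial.finite_mahlerMeasure_le n B.toNNReal).subset fun P hP => ⟨hP.1, ?_⟩
  exact hP.2.le.trans (Real.le_coe_toNNReal B)

/-! ### Linear forms from the shifts of two polynomials -/

open Polynomial in
-- A relation reads `U * P + V * Q = 0` with `deg V < q ≤ deg P`. Since `P` is prime and does not
-- divide `Q`, it divides `V`, so `V = 0` and then `U = 0`.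
theorem linearIndependent_shifts {P Q : ℤ[X]} (hP : Irreducible P) (hPQ : ¬ P ∣ Q) (p q : ℕ)
    (hq : q ≤ P.natDegree) :
    LinearIndependent ℤ (Fin.append (fun i : Fin p => X ^ (i : ℕ) * P)
      (fun i : Fin q => X ^ (i : ℕ) * Q)) := by
  rw [Fintype.linearIndependent_iff]
  intro c hc
  let U := ofFn p fun i => c (Fin.castAdd q i)
  let V := ofFn q fun i => c (Fin.natAdd p i)
  have hUV : U * P + V * Q = 0 := by
    rw [← hc, Fin.sum_univ_add]
    simp only [Fin.append_left, Fin.append_right, U, V, ofFn_eq_sum_monomial, Finset.sum_mul]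
    congr 1 <;> refine Finset.sum_congr rfl fun i _ => ?_ <;>
    · rw [← C_mul_X_pow_eq_monomial, mul_assoc, zsmul_eq_mul]; simp
  have hPV : P ∣ V := by
    refine (hP.prime.dvd_or_dvd (?_ : P ∣ V * Q)).resolve_right hPQ
    exact (dvd_add_right (dvd_mul_left P U)).1 (hUV ▸ dvd_zero P)
  have hV : V = 0 := by
    refine eq_zero_of_dvd_of_degree_lt hPV ?_
    rw [degree_eq_natDegree hP.ne_zero]
    exact (ofFn_degree_lt _).trans_le (by exact_mod_cast hq)
  have hU : U = 0 := by
    rw [hV, zero_mul, add_zero] at hUV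
    exact (mul_eq_zero.1 hUV).resolve_right hP.ne_zero
  intro i
  refine Fin.addCases (fun i => ?_) (fun i => ?_) i
  · have : U.coeff i = c (Fin.castAdd q i) := ofFn_coeff_eq_val_of_lt _ i.2
    rw [← this, hU, coeff_zero]
  · have : V.coeff i = c (Fin.natAdd p i) := ofFn_coeff_eq_val_of_lt _ i.2
    rw [← this, hV, coeff_zero]

open Polynomial in
/-- The shifts `T ^ i * P` and `T ^ i * Q` form an independent system of linear forms with
controlled coefficients and values. -/
theorem exists_system_of_pair {k p q : ℕ} (ξ : ℝ) {P Q : ℤ[X]} (hP : Irreducible P)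
    (hPQ : ¬ P ∣ Q) (hq : q ≤ P.natDegree) (hPk : P.natDegree + p ≤ k + 1)
    (hQk : Q.natDegree + q ≤ k + 1) {hp hq' ρ : ℝ}
    (hPc : ∀ i, |(P.coeff i : ℝ)| ≤ hp) (hQc : ∀ i, |(Q.coeff i : ℝ)| ≤ hq')
    (hPv : |aeval ξ P| ≤ hp * ρ) (hQv : |aeval ξ Q| ≤ hq' * ρ) :
    ∃ (a₀ : Fin (p + q) → ℤ) (a : Matrix (Fin (p + q)) (Fin k) ℤ) (h : Fin (p + q) → ℝ),
      (∀ c : Fin (p + q) → ℤ, ∑ i, c i * a₀ i = 0 → (∀ j, ∑ i, c i * a i j = 0) → c = 0) ∧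
      (∀ i j, |(a i j : ℝ)| ≤ h i) ∧
      (∀ i, |(a₀ i : ℝ) + ∑ j, veronese k ξ j * (a i j : ℝ)| ≤ h i * (max 1 |ξ| ^ k * ρ)) ∧
      ∏ i, h i = hp ^ p * hq' ^ q := by
  let R : Fin (p + q) → ℤ[X] := Fin.append (fun i : Fin p => X ^ (i : ℕ) * P)
      (fun i : Fin q => X ^ (i : ℕ) * Q)
  let h : Fin (p + q) → ℝ := Fin.append (fun _ => hp) (fun _ => hq')
  have hRdeg : ∀ i, (R i).natDegree ≤ k := by
    intro i
    refine Fin.addCases (fun i => ?_) (fun i => ?_) i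
    · simp only [R, Fin.append_left]
      refine natDegree_mul_le.trans ?_
      rw [natDegree_X_pow]; have := i.2; omega
    · simp only [R, Fin.append_right]
      refine natDegree_mul_le.trans ?_
      rw [natDegree_X_pow]; have := i.2; omega
  have hshift : ∀ (S : ℤ[X]) (B : ℝ), (∀ i, |(S.coeff i : ℝ)| ≤ B) → ∀ i j,
      |((X ^ i * S).coeff j : ℝ)| ≤ B := by
    intro S B hS i j
    rw [coeff_X_pow_mul']
    split_ifs
    · exact hS _
    · simpa using (abs_nonneg _).trans (hS 0)
  have hval : ∀ (S : ℤ[X]) (B : ℝ), |aeval ξ S| ≤ B → ∀ i ≤ k,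
      |aeval ξ (X ^ i * S)| ≤ max 1 |ξ| ^ k * B := by
    intro S B hS i hi
    rw [map_mul, map_pow, aeval_X, abs_mul, abs_pow]
    refine mul_le_mul ?_ hS (abs_nonneg _) (by positivity)
    calc |ξ| ^ i ≤ max 1 |ξ| ^ i := by gcongr; exact le_max_right _ _
      _ ≤ max 1 |ξ| ^ k := pow_le_pow_right₀ (le_max_left _ _) hi
  refine ⟨fun i => (R i).coeff 0, Matrix.of fun i j => (R i).coeff (j + 1), h, ?_, ?_, ?_, ?_⟩
  · intro c hc0 hc
    refine funext (Fintype.linearIndependent_iff.1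
      (linearIndependent_shifts hP hPQ p q hq) c ?_)
    ext j
    rw [finsetSum_coeff, coeff_zero]
    simp only [coeff_smul, smul_eq_mul]
    rcases j with _ | j
    · exact hc0
    · by_cases hj : j < k
      · exact hc ⟨j, hj⟩
      · refine Finset.sum_eq_zero fun i _ => ?_
        rw [coeff_eq_zero_of_natDegree_lt ((hRdeg i).trans_lt (by omega)), mul_zero]
  · intro i j
    refine Fin.addCases (fun i => ?_) (fun i => ?_) i
    · simpa [R, h] using hshift P hp hPc i (j + 1)
    · simpa [R, h] using hshift Q hq' hQc i (j + 1)
  · intro i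
    simp only [Matrix.of_apply]
    rw [← aeval_eq_coeff_zero_add_sum_veronese ξ (hRdeg i), mul_left_comm]
    refine Fin.addCases (fun i => ?_) (fun i => ?_) i
    · simp only [R, h, Fin.append_left]
      exact hval P _ hPv i (by have := i.2; omega)
    · simp only [R, h, Fin.append_right]
      exact hval Q _ hQv i (by have := i.2; omega)
  · simp [h, Fin.prod_univ_add]

/-! ### Small polynomial values and irreducible factors -/

/-- There is a nonzero integer polynomial of degree at most `n` and Mahler measure at most `C * X`
whose value at `ξ` is at most `X ^ (-w)`. -/
def PolySolvable (n : ℕ) (ξ C w X : ℝ) : Prop :=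
  ∃ Q : Polynomial ℤ, Q ≠ 0 ∧ Q.natDegree ≤ n ∧ intMahler Q ≤ C * X ∧
    |Polynomial.aeval ξ Q| ≤ X ^ (-w)

theorem PolySolvable.mono {n : ℕ} {ξ C w w' X : ℝ} (h : PolySolvable n ξ C w X) (hX : 1 ≤ X)
    (hw : w' ≤ w) : PolySolvable n ξ C w' X := by
  obtain ⟨Q, h0, hd, hM, hv⟩ := h
  exact ⟨Q, h0, hd, hM, hv.trans (Real.rpow_le_rpow_of_exponent_le hX (by linarith))⟩

open Polynomial in
theorem exists_polySolvable_of_linSolvable (n : ℕ) (ξ : ℝ) : ∃ C ≥ 1, ∀ w ≥ 0, ∀ X ≥ 1,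
    LinSolvable (veronese n ξ) w X → PolySolvable n ξ C w X := by
  set S : ℝ := 1 + ∑ j, |veronese n ξ j| with hS
  have hS1 : 1 ≤ S := le_add_of_nonneg_right (Finset.sum_nonneg fun _ _ => abs_nonneg _)
  refine ⟨(n + 1) * S, ?_, ?_⟩
  · have : (0 : ℝ) ≤ n := Nat.cast_nonneg n
    nlinarith
  rintro w hw X hX ⟨x₀, x, hne, hx, hval⟩
  have hX1 : X ^ (-w) ≤ 1 := Real.rpow_le_one_of_one_le_of_nonpos hX (by linarith)
  let c : Fin (n + 1) → ℤ := Fin.cons x₀ x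
  let Q : ℤ[X] := ofFn (n + 1) c
  have hc0 : Q.coeff 0 = x₀ := ofFn_coeff_eq_val_of_lt c (Nat.succ_pos n)
  have hcs : ∀ j : Fin n, Q.coeff (j + 1) = x j :=
    fun j => ofFn_coeff_eq_val_of_lt c (Nat.succ_lt_succ j.2)
  have hdeg : Q.natDegree ≤ n := Nat.le_of_lt_succ (ofFn_natDegree_lt (Nat.le_add_left 1 n) c)
  have heval : aeval ξ Q = (x₀ : ℝ) + ∑ j, veronese n ξ j * (x j : ℝ) := by
    rw [aeval_eq_coeff_zero_add_sum_veronese ξ hdeg, hc0]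
    simp only [hcs]
  -- The linear system does not bound `x₀`; it is recovered from the other coefficients and the
  -- value, which is at most 1.
  have hx₀ : |(x₀ : ℝ)| ≤ S * X := by
    have h1 : |∑ j, veronese n ξ j * (x j : ℝ)| ≤ (∑ j, |veronese n ξ j|) * X := by
      rw [Finset.sum_mul]
      refine (Finset.abs_sum_le_sum_abs _ _).trans (Finset.sum_le_sum fun j _ => ?_)
      rw [abs_mul]
      exact mul_le_mul_of_nonneg_left (hx j) (abs_nonneg _)
    have h2 : (x₀ : ℝ) = ((x₀ : ℝ) + ∑ j, veronese n ξ j * (x j : ℝ)) -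
      ∑ j, veronese n ξ j * (x j : ℝ) := by ring
    rw [h2]
    refine (abs_sub _ _).trans ?_
    rw [hS, add_mul]
    linarith
  have hcoeff : ∀ i, |(Q.coeff i : ℝ)| ≤ S * X := by
    intro i
    rcases i with _ | i
    · rwa [hc0]
    · by_cases hi : i < n
      · rw [hcs ⟨i, hi⟩]
        exact (hx _).trans (le_mul_of_one_le_left (by linarith) hS1)
      · rw [coeff_eq_zero_of_natDegree_lt (by omega)]
        simp only [Int.cast_zero, abs_zero]
        positivity
  refine ⟨Q, ?_, hdeg, ?_, by rwa [heval]⟩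
  · intro h0
    apply hne
    rw [h0] at hc0
    simp only [h0, coeff_zero] at hcs hc0
    rw [Prod.mk_eq_zero]
    exact ⟨hc0.symm, funext fun j => (hcs j).symm⟩
  · rw [mul_assoc]
    exact intMahler_le hdeg hcoeff

open Polynomial in
theorem aeval_int_ne_zero {ξ : ℝ} (hξ : Transcendental ℚ ξ) {P : ℤ[X]} (hP : P ≠ 0) :
    aeval ξ P ≠ 0 := by
  intro h
  have h' := transcendental_iff.1 hξ (P.map (algebraMap ℤ ℚ)) (by rwa [aeval_map_algebraMap])
  exact hP ((Polynomial.map_eq_zero_iff (algebraMap ℤ ℚ).injective_int).1 h')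

open Polynomial in
-- Both sides are multiplicative, so the bound passes from irreducible factors to products. This is
-- why heights are measured by the Mahler measure.
theorem mul_rpow_neg_intMahler_le {n : ℕ} {ξ c w : ℝ} (hc0 : 0 < c) (hc1 : c ≤ 1) (hw : 0 ≤ w)
    (h : ∀ P : ℤ[X], Irreducible P → 1 ≤ P.natDegree → P.natDegree ≤ n →
      c * intMahler P ^ (-w) ≤ |aeval ξ P|) (Q : ℤ[X]) (hQ : Q ≠ 0) (hn : Q.natDegree ≤ n) :
    c ^ Q.natDegree * intMahler Q ^ (-w) ≤ |aeval ξ Q| := by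
  have hM : ∀ P : ℤ[X], P ≠ 0 → intMahler P ^ (-w) ≤ 1 := fun P hP =>
    Real.rpow_le_one_of_one_le_of_nonpos (one_le_intMahler hP) (by linarith)
  have hconst : ∀ P : ℤ[X], P ≠ 0 → P.natDegree = 0 →
      c ^ P.natDegree * intMahler P ^ (-w) ≤ |aeval ξ P| := by
    intro P hP h0
    rw [h0, pow_zero, one_mul]
    refine (hM P hP).trans ?_
    obtain ⟨z, rfl⟩ := natDegree_eq_zero.1 h0
    have hz : z ≠ 0 := fun hz => hP (by simp [hz])
    rw [aeval_C, algebraMap_int_eq, eq_intCast]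
    exact_mod_cast Int.one_le_abs hz
  induction Q using WfDvdMonoid.induction_on_irreducible with
  | zero => exact absurd rfl hQ
  | unit u hu => exact hconst u hQ (natDegree_eq_zero_of_isUnit hu)
  | mul a P ha hP ih =>
    rw [natDegree_mul hP.ne_zero ha] at hn ⊢
    have h1 := ih ha (by omega)
    have h2 : c ^ P.natDegree * intMahler P ^ (-w) ≤ |aeval ξ P| := by
      rcases Nat.eq_zero_or_pos P.natDegree with h0 | h0
      · exact hconst P hP.ne_zero h0
      · refine le_trans ?_ (h P hP h0 (by omega))
        refine mul_le_mul_of_nonneg_right ?_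
          (Real.rpow_nonneg (intMahler_nonneg _) _)
        exact pow_le_of_le_one hc0.le hc1 h0.ne'
    rw [map_mul, abs_mul, intMahler_mul, Real.mul_rpow (intMahler_nonneg _)
      (intMahler_nonneg _), pow_add]
    calc _ = (c ^ P.natDegree * intMahler P ^ (-w)) * (c ^ a.natDegree * intMahler a ^ (-w)) := by
          ring
      _ ≤ _ := mul_le_mul h2 h1 (mul_nonneg (by positivity)
          (Real.rpow_nonneg (intMahler_nonneg _) _)) (abs_nonneg _)

open Polynomial in
-- Otherwise all irreducible polynomials of measure at least `B` satisfy a lower bound of exponent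
-- `w'`. The finitely many of smaller measure have nonzero values and only cost a constant `c`. The
-- bound then extends to all nonzero polynomials, against the exponent `w > w'`.
theorem exists_irreducible_of_frequently {n : ℕ} {ξ C w w' : ℝ} (hξ : Transcendental ℚ ξ)
    (hC : 0 < C) (hw' : 0 ≤ w') (hw : w' < w)
    (hfreq : ∃ᶠ X in atTop, PolySolvable n ξ C w X) (B : ℝ) :
    ∃ P : ℤ[X], Irreducible P ∧ 1 ≤ P.natDegree ∧ P.natDegree ≤ n ∧ B ≤ intMahler P ∧
      |aeval ξ P| ≤ intMahler P ^ (-w') := by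
  by_contra! hno
  obtain ⟨c, hc0, hc1, hc⟩ : ∃ c : ℝ, 0 < c ∧ c ≤ 1 ∧ ∀ P : ℤ[X], P ≠ 0 → P.natDegree ≤ n →
      intMahler P < B → c ≤ |aeval ξ P| := by
    have hfin := (finite_intMahler_lt n B).subset
      (fun P (hP : P ≠ 0 ∧ P.natDegree ≤ n ∧ intMahler P < B) => hP.2)
    rcases Set.eq_empty_or_nonempty {P : ℤ[X] | P ≠ 0 ∧ P.natDegree ≤ n ∧ intMahler P < B}
      with he | hne
    · refine ⟨1, one_pos, le_rfl, fun P h1 h2 h3 => ?_⟩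
      exact absurd (show P ∈ {P : ℤ[X] | P ≠ 0 ∧ P.natDegree ≤ n ∧ intMahler P < B} from
        ⟨h1, h2, h3⟩) (he ▸ Set.notMem_empty P)
    · obtain ⟨P₀, hP₀, hmin⟩ := Set.exists_min_image _ (fun P : ℤ[X] => |aeval ξ P|) hfin hne
      exact ⟨min 1 |aeval ξ P₀|, lt_min one_pos (abs_pos.2 (aeval_int_ne_zero hξ hP₀.1)),
        min_le_left _ _, fun P h1 h2 h3 => (min_le_right _ _).trans (hmin P ⟨h1, h2, h3⟩)⟩
  have hirr : ∀ P : ℤ[X], Irreducible P → 1 ≤ P.natDegree → P.natDegree ≤ n →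
      c * intMahler P ^ (-w') ≤ |aeval ξ P| := by
    intro P hP h1 h2
    have hpos : 0 ≤ intMahler P ^ (-w') := Real.rpow_nonneg (intMahler_nonneg _) _
    rcases lt_or_ge (intMahler P) B with hB | hB
    · refine le_trans ?_ (hc P hP.ne_zero h2 hB)
      refine mul_le_of_le_one_right hc0.le ?_
      exact Real.rpow_le_one_of_one_le_of_nonpos (one_le_intMahler hP.ne_zero) (by linarith)
    · exact (mul_le_of_le_one_left hpos hc1).trans (hno P hP h1 h2 hB).le
  have hlim : Tendsto (fun X : ℝ => X ^ (w - w')) atTop atTop :=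
    tendsto_rpow_atTop (by linarith)
  obtain ⟨X, ⟨Q, hQ0, hQd, hQM, hQv⟩, hX, hX0⟩ := (hfreq.and_eventually
    ((hlim.eventually_gt_atTop (C ^ w' / c ^ n)).and (eventually_gt_atTop 0))).exists
  have h1 := mul_rpow_neg_intMahler_le hc0 hc1 hw' hirr Q hQ0 hQd
  have hM : 0 < intMahler Q := one_pos.trans_le (one_le_intMahler hQ0)
  have h2 : c ^ n * (C * X) ^ (-w') ≤ X ^ (-w) := by
    refine le_trans ?_ (h1.trans hQv)
    refine mul_le_mul (pow_le_pow_of_le_one hc0.le hc1 hQd) ?_ (by positivity) (by positivity)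
    exact Real.rpow_le_rpow_of_nonpos hM hQM (by linarith)
  rw [div_lt_iff₀ (by positivity)] at hX
  rw [Real.mul_rpow hC.le hX0.le] at h2
  have h3 : X ^ (w - w') * c ^ n ≤ C ^ w' := by
    calc X ^ (w - w') * c ^ n = C ^ w' * X ^ w * (c ^ n * (C ^ (-w') * X ^ (-w'))) := by
          rw [Real.rpow_sub hX0, Real.rpow_neg hC.le, Real.rpow_neg hX0.le]; field_simp
      _ ≤ C ^ w' * X ^ w * X ^ (-w) := by gcongr
      _ = C ^ w' := by rw [mul_assoc, ← Real.rpow_add hX0]; simp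
  linarith

/-! ### Coprime pairs and the approximations they produce -/

open Polynomial in
/-- `P` and `Q` are coprime integer polynomials of degree at most `n` and Mahler measure at most
`H` with values at most `K * H ^ (-v)` at `ξ`, and `P` is irreducible. -/
structure IsCoprimePair (n : ℕ) (ξ K v H : ℝ) (P Q : ℤ[X]) : Prop where
  irreducible : Irreducible P
  not_dvd : ¬ P ∣ Q
  one_le_natDegree : 1 ≤ P.natDegree
  natDegree_left_le : P.natDegree ≤ n
  natDegree_right_le : Q.natDegree ≤ n
  intMahler_left_le : intMahler P ≤ H
  intMahler_right_le : intMahler Q ≤ H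
  abs_left_le : |aeval ξ P| ≤ K * H ^ (-v)
  abs_right_le : |aeval ξ Q| ≤ K * H ^ (-v)

open Polynomial in
theorem eventually_isCoprimePair {n : ℕ} {ξ C v : ℝ} (hC : 1 ≤ C) (hv : 0 ≤ v)
    (hU : ∀ᶠ X in atTop, PolySolvable n ξ C v X) :
    ∀ᶠ H in atTop, ∀ P : ℤ[X], Irreducible P → 1 ≤ P.natDegree → P.natDegree ≤ n →
      intMahler P = H → |aeval ξ P| ≤ H ^ (-v) →
      ∃ Q : ℤ[X], IsCoprimePair n ξ ((2 * C) ^ v) v H P Q := by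
  have hlim : Tendsto (fun H : ℝ => H / (2 * C)) atTop atTop :=
    tendsto_id.atTop_div_const (by linarith)
  filter_upwards [hlim.eventually hU, eventually_gt_atTop 0] with H hH hH0 P hP h1 hn hM hPv
  obtain ⟨Q, hQ0, hQd, hQM, hQv⟩ := hH
  -- The search range `H / (2 * C)` makes `Q` have smaller measure than `P`, so `P` cannot divide
  -- it.
  have hQM' : intMahler Q ≤ H / 2 := by
    refine hQM.trans_eq ?_
    field_simp
  refine ⟨Q, hP, fun hdvd => ?_, h1, hn, hQd, hM.le, by linarith, ?_, ?_⟩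
  · have := intMahler_le_of_dvd hQ0 hdvd
    linarith
  · refine hPv.trans (le_mul_of_one_le_left (by positivity) ?_)
    exact Real.one_le_rpow (by linarith) hv
  · refine hQv.trans_eq ?_
    rw [Real.div_rpow hH0.le (by linarith), Real.rpow_neg (by linarith : (0 : ℝ) ≤ 2 * C)]
    field_simp

open Polynomial in
theorem IsCoprimePair.exists_system {n k p q : ℕ} {ξ K v H : ℝ} {P Q : ℤ[X]}
    (h : IsCoprimePair n ξ K v H P Q) (hH : 0 < H) (hK : 0 ≤ K) (hq : q ≤ P.natDegree)
    (hPk : P.natDegree + p ≤ k + 1) (hQk : n + q ≤ k + 1) :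
    ∃ (a₀ : Fin (p + q) → ℤ) (a : Matrix (Fin (p + q)) (Fin k) ℤ) (h : Fin (p + q) → ℝ),
      (∀ c : Fin (p + q) → ℤ, ∑ i, c i * a₀ i = 0 → (∀ j, ∑ i, c i * a i j = 0) → c = 0) ∧
      (∀ i j, |(a i j : ℝ)| ≤ h i) ∧
      (∀ i, |(a₀ i : ℝ) + ∑ j, veronese k ξ j * (a i j : ℝ)| ≤
        h i * (max 1 |ξ| ^ k * (K * H ^ (-v - 1)))) ∧
      ∏ i, h i = (2 ^ n) ^ (p + q) * H ^ ((p : ℝ) + q) := by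
  have hval : K * H ^ (-v) ≤ 2 ^ n * H * (K * H ^ (-v - 1)) := by
    rw [Real.rpow_sub_one hH.ne']
    have : (1 : ℝ) ≤ 2 ^ n := one_le_pow₀ (by norm_num)
    calc K * H ^ (-v) ≤ 2 ^ n * (K * H ^ (-v)) := le_mul_of_one_le_left (by positivity) this
      _ = _ := by field_simp
  have hPc : ∀ i, |(P.coeff i : ℝ)| ≤ 2 ^ n * H := fun i =>
    (abs_coeff_le_intMahler h.natDegree_left_le i).trans
      (mul_le_mul_of_nonneg_left h.intMahler_left_le (by positivity))
  have hQc : ∀ i, |(Q.coeff i : ℝ)| ≤ 2 ^ n * H := fun i =>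
    (abs_coeff_le_intMahler h.natDegree_right_le i).trans
      (mul_le_mul_of_nonneg_left h.intMahler_right_le (by positivity))
  obtain ⟨a₀, a, b, h1, h2, h3, h4⟩ := exists_system_of_pair (k := k) (p := p) (q := q) ξ
    h.irreducible h.not_dvd hq hPk (by have := h.natDegree_right_le; omega) hPc hQc
    (h.abs_left_le.trans hval) (h.abs_right_le.trans hval)
  refine ⟨a₀, a, b, h1, h2, h3, h4.trans ?_⟩
  rw [← pow_add, mul_pow, ← Nat.cast_add, Real.rpow_natCast]

/-- A resultant argument: `n` shifts of `P` and `deg P` shifts of `Q` are `n + deg P` independent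
forms in as many variables. For larger `v` their heights times `ρ` would tend to 0, which is
impossible when `m = k + 1`. -/
theorem eventually_le_of_isCoprimePair (n : ℕ) (ξ K v : ℝ) (hK : 0 ≤ K) :
    ∀ᶠ H in atTop, ∀ P Q, IsCoprimePair n ξ K v H P Q → v ≤ n + P.natDegree - 1 := by
  suffices h : ∀ d : Fin (n + 1), ∀ᶠ H : ℝ in atTop, ∀ P Q, IsCoprimePair n ξ K v H P Q →
      P.natDegree = d → v ≤ n + (d : ℕ) - 1 by
    filter_upwards [eventually_all.2 h] with H hH P Q hPQ
    exact hH ⟨P.natDegree, Nat.lt_succ_of_le hPQ.natDegree_left_le⟩ P Q hPQ rfl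
  intro d
  by_cases hvd : v ≤ n + (d : ℕ) - 1
  · exact Eventually.of_forall fun _ _ _ _ _ => hvd
  push Not at hvd
  set E : ℝ := (n + d : ℕ).factorial * ((2 ^ n) ^ (n + (d : ℕ)) *
    (max 1 |ξ| ^ (n + (d : ℕ) - 1) * K))
  have e1 : Tendsto (fun H : ℝ => E * H ^ (-(v - (n + (d : ℕ) - 1)))) atTop (nhds 0) := by
    simpa using (tendsto_rpow_neg_atTop (sub_pos.2 hvd)).const_mul E
  filter_upwards [e1.eventually_lt_const one_pos, eventually_gt_atTop 0] with H h1 hH P Q hPQ hd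
  have hd1 := hPQ.one_le_natDegree
  obtain ⟨a₀, a, b, hlin, ha, hv, hprod⟩ := hPQ.exists_system (k := n + d - 1) (p := n) (q := d) hH
    hK hd.ge (by omega) (by omega)
  have := (exists_simultaneous_approximation a₀ a _ b _ 1 hlin ha hv (by
    refine lt_of_eq_of_lt ?_ h1
    rw [hprod]
    have : H ^ (-(v - (n + (d : ℕ) - 1))) = H ^ ((n : ℝ) + (d : ℕ)) * H ^ (-v - 1) := by
      rw [← Real.rpow_add hH]; congr 1; ring
    rw [this]
    simp only [E]
    ring)).1
  omega

/-- With `m = p + q`, all heights are of order `H`, so `γ = m` and `β = v + 1 - m`; the denominator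
`(k + 1 - m) γ + (k - m) β` collapses to `(k - m) v + k`. -/
theorem eventually_simSolvable_of_isCoprimePair {n k p q : ℕ} {ξ K v l : ℝ} (hK : 1 ≤ K)
    (hm : 1 ≤ p + q) (hmk : p + q ≤ k) (hβ : 0 < v + 1 - (p + q))
    (hl : l * (((k : ℝ) - (p + q)) * v + k) < v + 1 - (p + q)) (B : ℝ) :
    ∀ᶠ H in atTop, ∀ P Q, IsCoprimePair n ξ K v H P Q → q ≤ P.natDegree →
      P.natDegree + p ≤ k + 1 → n + q ≤ k + 1 → ∃ X ≥ B, SimSolvable (veronese k ξ) l X := by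
  have hmk' : ((p : ℝ) + q) ≤ k := by exact_mod_cast hmk
  have hm' : (1 : ℝ) ≤ p + q := by exact_mod_cast hm
  have hmx : (1 : ℝ) ≤ max 1 |ξ| ^ k := one_le_pow₀ (le_max_left _ _)
  have e := eventually_simSolvable_of_system (m := p + q) (veronese k ξ)
    ((2 ^ n) ^ (p + q) * (max 1 |ξ| ^ k * K)) (v + 1 - (p + q)) (p + q) l (by positivity) hβ hmk
    (by push_cast; nlinarith) (by push_cast; refine lt_of_eq_of_lt ?_ hl; ring) B
  filter_upwards [e, eventually_gt_atTop 0] with H he hH P Q hPQ hq hPk hQk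
  obtain ⟨a₀, a, b, hlin, ha, hv, hprod⟩ := hPQ.exists_system hH (by linarith) hq hPk hQk
  refine he a₀ a b _ hlin ha hv ?_ ?_
  · rw [hprod]
    refine mul_le_mul_of_nonneg_right ?_ (by positivity)
    exact le_mul_of_one_le_right (by positivity) (one_le_mul_of_one_le_of_one_le hmx hK)
  · rw [hprod]
    refine le_of_eq ?_
    have : H ^ (-(v + 1 - ((p : ℝ) + q))) = H ^ ((p : ℝ) + q) * H ^ (-v - 1) := by
      rw [← Real.rpow_add hH]; congr 1; ring
    rw [this]
    ring

open Polynomial in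
-- The case of unequal heights: `X ^ b` for the `r` shifts of `P` and `X` for those of `Q`, so `γ =
-- r (1 + b)`. Normalising the values by the height of `P` cancels one factor `X ^ b`, whence `β = v
-- - r - b (r - 1)`.
theorem eventually_simSolvable_of_natDegree_eq {n k r : ℕ} {ξ C v b l : ℝ} (hC : 1 ≤ C)
    (hr : 1 ≤ r) (hrn : r ≤ n) (hrk : n + r ≤ k + 1) (hmk : 2 * r ≤ k) (hb : 0 ≤ b)
    (hβ : 0 < v - r - b * (r - 1))
    (hl : l * (((k : ℝ) + 1 - 2 * r) * (r * (1 + b)) +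
      ((k : ℝ) - 2 * r) * (v - r - b * (r - 1))) < v - r - b * (r - 1)) (B : ℝ) :
    ∀ᶠ X in atTop, ∀ P Q : ℤ[X], Irreducible P → P.natDegree = n → Q.natDegree ≤ n → ¬ P ∣ Q →
      intMahler P ≤ X → intMahler P ≤ X ^ b → |aeval ξ P| ≤ 2 ^ v * X ^ (-v) →
      intMahler Q ≤ C * X → |aeval ξ Q| ≤ |aeval ξ P| →
      ∃ X' ≥ B, SimSolvable (veronese k ξ) l X' := by
  have hmk' : (2 * (r : ℝ)) ≤ k := by exact_mod_cast hmk
  have hr' : (1 : ℝ) ≤ r := by exact_mod_cast hr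
  have hmx : (1 : ℝ) ≤ max 1 |ξ| ^ k := one_le_pow₀ (le_max_left _ _)
  have hm2 : ((r + r : ℕ) : ℝ) = 2 * r := by push_cast; ring
  have hv : 0 < v := by nlinarith [mul_nonneg hb (sub_nonneg.2 hr')]
  have hpos : 0 < ((k : ℝ) + 1 - 2 * r) * (r * (1 + b)) +
      ((k : ℝ) - 2 * r) * (v - r - b * (r - 1)) := by
    have h1 : 0 < ((k : ℝ) + 1 - 2 * r) * (r * (1 + b)) :=
      mul_pos (by linarith) (by positivity)
    have h2 : 0 ≤ ((k : ℝ) - 2 * r) * (v - r - b * (r - 1)) :=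
      mul_nonneg (by linarith) hβ.le
    linarith
  have h2v : (1 : ℝ) ≤ 2 ^ v := Real.one_le_rpow (by norm_num) hv.le
  have h2n : (1 : ℝ) ≤ 2 ^ n := one_le_pow₀ (by norm_num)
  have e := eventually_simSolvable_of_system (m := r + r) (veronese k ξ)
    ((2 ^ n) ^ (2 * r) * C ^ r * (max 1 |ξ| ^ k * 2 ^ v)) (v - r - b * (r - 1)) (r * (1 + b)) l
    (by positivity) hβ (by omega) (by rw [hm2]; exact hpos) (by rw [hm2]; exact hl) B
  filter_upwards [e, eventually_gt_atTop 0] with X he hX P Q hP hPn hQn hPQ hPX hPb hPv hQX hQv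
  have hM : 0 < intMahler P := one_pos.trans_le (one_le_intMahler hP.ne_zero)
  set M := intMahler P with hMdef
  set t := |aeval ξ P| with ht
  have ht0 : 0 ≤ t := abs_nonneg _
  obtain ⟨a₀, a, h, hlin, ha, hval, hprod⟩ := exists_system_of_pair (k := k) (p := r) (q := r)
    (hp := 2 ^ n * M) (hq' := 2 ^ n * (C * X)) (ρ := t / (2 ^ n * M)) ξ hP hPQ (by omega)
    (by omega) (by omega) (abs_coeff_le_intMahler hPn.le)
    (fun i => (abs_coeff_le_intMahler hQn i).trans (by gcongr))
    (by rw [mul_div_cancel₀]; positivity)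
    (by
      refine hQv.trans ?_
      rw [← mul_div_assoc, le_div_iff₀ (by positivity), mul_comm]
      gcongr
      exact hPX.trans (le_mul_of_one_le_left hX.le hC))
  have hXb : ∀ j : ℕ, M ^ j ≤ X ^ (b * j) := fun j => by
    rw [Real.rpow_mul hX.le, Real.rpow_natCast]
    gcongr
  refine he a₀ a h _ hlin ha hval ?_ ?_
  · rw [hprod]
    calc (2 ^ n * M) ^ r * (2 ^ n * (C * X)) ^ r
        = ((2 ^ n) ^ (2 * r) * C ^ r) * (M ^ r * X ^ r) := by
          rw [two_mul, pow_add]; simp only [mul_pow]; ring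
      _ ≤ ((2 ^ n) ^ (2 * r) * C ^ r) * (X ^ (b * r) * X ^ (r : ℝ)) := by
          rw [Real.rpow_natCast X r]
          gcongr
          exact hXb r
      _ = ((2 ^ n) ^ (2 * r) * C ^ r) * 1 * X ^ (r * (1 + b)) := by
          rw [← Real.rpow_add hX]; ring_nf
      _ ≤ _ := by
          gcongr
          exact one_le_mul_of_one_le_of_one_le hmx h2v
  · rw [hprod]
    obtain ⟨r', rfl⟩ : ∃ r', r = r' + 1 := ⟨r - 1, by omega⟩
    calc (2 ^ n * M) ^ (r' + 1) * (2 ^ n * (C * X)) ^ (r' + 1) *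
          (max 1 |ξ| ^ k * (t / (2 ^ n * M)))
        = (2 ^ n) ^ (2 * r' + 1) * C ^ (r' + 1) * max 1 |ξ| ^ k * (M ^ r' * X ^ (r' + 1) * t) := by
          field_simp
          ring
      _ ≤ (2 ^ n) ^ (2 * (r' + 1)) * C ^ (r' + 1) * max 1 |ξ| ^ k *
          (X ^ (b * r') * X ^ ((r' + 1 : ℕ) : ℝ) * (2 ^ v * X ^ (-v))) := by
          rw [Real.rpow_natCast X (r' + 1)]
          have h1 : ((2 : ℝ) ^ n) ^ (2 * r' + 1) ≤ (2 ^ n) ^ (2 * (r' + 1)) :=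
            pow_le_pow_right₀ h2n (by omega)
          gcongr
          exact hXb r'
      _ = (2 ^ n) ^ (2 * (r' + 1)) * C ^ (r' + 1) * (max 1 |ξ| ^ k * 2 ^ v) *
          (X ^ (b * r') * X ^ ((r' + 1 : ℕ) : ℝ) * X ^ (-v)) := by ring
      _ = _ := by
          rw [← Real.rpow_add hX, ← Real.rpow_add hX]
          congr 2
          push_cast; ring

/-! ### Exponents as suprema -/

theorem coe_le_simExponent {N : ℕ} {ξ : Fin N → ℝ} {t : ℝ}
    (h : ∀ l < t, ∀ B, ∃ X ≥ B, SimSolvable ξ l X) : (t : EReal) ≤ simExponent ξ := by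
  by_contra! hlt
  obtain ⟨l, hl1, hl2⟩ := EReal.lt_iff_exists_real_btwn.1 hlt
  refine absurd (le_sSup ⟨l, ?_, rfl⟩ : (l : EReal) ≤ simExponent ξ) (not_le.2 hl1)
  exact frequently_atTop.2 (h l (EReal.coe_lt_coe_iff.1 hl2))

/-- Dirichlet's theorem, as the case of an empty system of forms: `m = 0`, `γ = 0`, `β = 1`. -/
theorem one_div_le_simExponent {k : ℕ} (hk : 1 ≤ k) (ξ : Fin k → ℝ) :
    ((1 / k : ℝ) : EReal) ≤ simExponent ξ := by
  have hk' : (1 : ℝ) ≤ k := by exact_mod_cast hk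
  refine coe_le_simExponent fun l hl B => ?_
  rw [lt_div_iff₀ (by linarith)] at hl
  obtain ⟨H, hH, hH0⟩ := ((eventually_simSolvable_of_system (m := 0) ξ 1 1 0 l one_pos one_pos
    (Nat.zero_le _) (by simp; linarith) (by simpa using hl) B).and (eventually_gt_atTop 0)).exists
  exact hH 0 0 0 0 (fun c _ _ => Subsingleton.elim _ _) (fun i => i.elim0) (fun i => i.elim0)
    (by simp) (by simp; positivity)

theorem exists_uniformLinExponent_eq {n : ℕ} {ξ : ℝ} {b : ℝ}
    (hb : ∀ w, 0 ≤ w → (∀ᶠ X in atTop, LinSolvable (veronese n ξ) w X) → w ≤ b) :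
    ∃ v : ℝ, 0 ≤ v ∧ uniformLinExponent (veronese n ξ) = (v : EReal) := by
  have h0 : ((0 : ℝ) : EReal) ≤ uniformLinExponent (veronese n ξ) := by
    refine le_sSup ⟨0, ?_, rfl⟩
    filter_upwards [eventually_ge_atTop 0] with X hX
    exact ⟨1, 0, by simp, fun j => by simpa using hX, by simp⟩
  have h1 : uniformLinExponent (veronese n ξ) ≤ ((max b 0 : ℝ) : EReal) := by
    refine sSup_le ?_
    rintro _ ⟨w, hw, rfl⟩
    rw [EReal.coe_le_coe_iff]
    rcases le_total 0 w with h | h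
    · exact (hb w h hw).trans (le_max_left _ _)
    · exact h.trans (le_max_right _ _)
  refine ⟨(uniformLinExponent (veronese n ξ)).toReal, ?_, (EReal.coe_toReal ?_ ?_).symm⟩
  · exact EReal.toReal_nonneg h0
  · exact ne_top_of_le_ne_top (EReal.coe_ne_top _) h1
  · exact ne_bot_of_le_ne_bot (EReal.coe_ne_bot _) h0

theorem uniformLinExponent_le_linExponent {N : ℕ} (ξ : Fin N → ℝ) :
    uniformLinExponent ξ ≤ linExponent ξ :=
  sSup_le_sSup (Set.image_mono fun _ hw => hw.frequently)

/-- The bounds below exceed `1 / k` only if the uniform exponent exceeds `k`. -/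
theorem div_le_one_div_of_le {m k v : ℝ} (hk : 0 < k) (hmk : m ≤ k) (hv : 0 ≤ v) (hvk : v ≤ k)
    (hm : 0 ≤ m) : (v + 1 - m) / ((k - m) * v + k) ≤ 1 / k := by
  have h0 : 0 < (k - m) * v + k := by
    have := mul_nonneg (sub_nonneg.2 hmk) hv
    linarith
  rw [div_le_div_iff₀ h0 hk]
  nlinarith [mul_nonneg hm (sub_nonneg.2 hvk)]

/-- Real exponents slightly below a supremum `v` satisfy any strict inequality valid at `v`. -/
theorem exists_lt_of_continuousAt {v a : ℝ} {f : ℝ → ℝ} (hf : ContinuousAt f v) (hfv : 0 < f v)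
    (ha : a < v) : ∃ v' < v, a < v' ∧ 0 < f v' := by
  have h1 : ∀ᶠ x in nhdsWithin v (Set.Iio v), 0 < f x :=
    nhdsWithin_le_nhds (hf.eventually_const_lt hfv)
  have h2 : ∀ᶠ x in nhdsWithin v (Set.Iio v), a < x :=
    nhdsWithin_le_nhds (eventually_gt_nhds ha)
  obtain ⟨x, hx⟩ := (h1.and (h2.and self_mem_nhdsWithin)).exists
  exact ⟨x, hx.2.2, hx.2.1, hx.1⟩

/-! ### The two bounds when the uniform exponent exceeds `k` -/

section

variable {n k : ℕ} {ξ C v : ℝ}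

theorem eventually_polySolvable_of_lt
    (hC : ∀ w ≥ 0, ∀ X ≥ 1, LinSolvable (veronese n ξ) w X → PolySolvable n ξ C w X)
    (hv : uniformLinExponent (veronese n ξ) = (v : EReal)) {v' : ℝ} (h0 : 0 ≤ v') (hv' : v' < v) :
    ∀ᶠ X in atTop, PolySolvable n ξ C v' X := by
  have : (v' : EReal) < uniformLinExponent (veronese n ξ) := by
    rw [hv]; exact EReal.coe_lt_coe_iff.2 hv'
  obtain ⟨_, ⟨w, hw, rfl⟩, hlt⟩ := lt_sSup_iff.1 this
  have hw' := EReal.coe_lt_coe_iff.1 hlt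
  filter_upwards [hw, eventually_ge_atTop 1] with X hX hX1
  exact (hC w (h0.trans hw'.le) X hX1 hX).mono hX1 hw'.le

theorem exists_irreducible_of_lt (hξ : Transcendental ℚ ξ) (hC1 : 1 ≤ C)
    (hC : ∀ w ≥ 0, ∀ X ≥ 1, LinSolvable (veronese n ξ) w X → PolySolvable n ξ C w X)
    {w : ℝ} (h0 : 0 ≤ w) (hw : (w : EReal) < linExponent (veronese n ξ)) (B : ℝ) :
    ∃ P : Polynomial ℤ, Irreducible P ∧ 1 ≤ P.natDegree ∧ P.natDegree ≤ n ∧ B ≤ intMahler P ∧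
      |Polynomial.aeval ξ P| ≤ intMahler P ^ (-w) := by
  obtain ⟨_, ⟨w', hw', rfl⟩, hlt⟩ := lt_sSup_iff.1 hw
  have hlt' := EReal.coe_lt_coe_iff.1 hlt
  refine exists_irreducible_of_frequently (C := C) hξ (by linarith) h0 hlt' ?_ B
  exact (Frequently.and_eventually hw' (eventually_ge_atTop 1)).mono fun X hX =>
    hC w' (h0.trans hlt'.le) X hX.2 hX.1

/-- For exponents `v' ≤ w` below the uniform and the ordinary exponent, an irreducible polynomial
of exponent `w` and large measure belongs to a coprime pair of exponent `v'`. -/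
theorem exists_isCoprimePair (hξ : Transcendental ℚ ξ) (hC1 : 1 ≤ C)
    (hC : ∀ w ≥ 0, ∀ X ≥ 1, LinSolvable (veronese n ξ) w X → PolySolvable n ξ C w X)
    {v' w : ℝ} (h0 : 0 ≤ v') (hU : ∀ᶠ X in atTop, PolySolvable n ξ C v' X)
    (hvw : v' ≤ w) (hw : (w : EReal) < linExponent (veronese n ξ))
    {p : ℝ → Prop} (hp : ∀ᶠ H in atTop, p H) :
    ∃ P Q, IsCoprimePair n ξ ((2 * C) ^ v') v' (intMahler P) P Q ∧
      |Polynomial.aeval ξ P| ≤ intMahler P ^ (-w) ∧ p (intMahler P) := by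
  obtain ⟨B, hB⟩ := eventually_atTop.1 ((eventually_isCoprimePair hC1 h0 hU).and hp)
  obtain ⟨P, hP, h1, hn, hBP, hPv⟩ := exists_irreducible_of_lt hξ hC1 hC (h0.trans hvw) hw B
  obtain ⟨Q, hQ⟩ := (hB _ hBP).1 P hP h1 hn rfl (hPv.trans
    (Real.rpow_le_rpow_of_exponent_le (one_le_intMahler hP.ne_zero) (by linarith)))
  exact ⟨P, Q, hQ, hPv, (hB _ hBP).2⟩

open Polynomial in
theorem exists_not_dvd_of_natDegree_eq (hξ : Transcendental ℚ ξ) {v' w b : ℝ} (hv0 : 0 < v')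
    (hU : ∀ᶠ X in atTop, PolySolvable n ξ C v' X) (hvw : v' ≤ w) (hb : v' ≤ b * w)
    {p : ℝ → Prop} (hp : ∀ᶠ X in atTop, p X) :
    ∀ᶠ H in atTop, ∀ P : ℤ[X], Irreducible P → P.natDegree = n → intMahler P = H →
      |aeval ξ P| ≤ H ^ (-w) →
      ∃ X Q, p X ∧ ¬ P ∣ Q ∧ Q.natDegree ≤ n ∧ H ≤ X ∧ H ≤ X ^ b ∧
        |aeval ξ P| ≤ 2 ^ v' * X ^ (-v') ∧ intMahler Q ≤ C * X ∧ |aeval ξ Q| ≤ |aeval ξ P| := by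
  obtain ⟨B, hB⟩ := eventually_atTop.1 (hU.and hp)
  have hw0 : 0 < w := hv0.trans_le hvw
  filter_upwards [eventually_ge_atTop B, eventually_ge_atTop 1] with H hHB hH1 P hP hPn hPH hPv
  have hH0 : 0 < H := by linarith
  set t := |aeval ξ P| with ht
  have ht0 : 0 < t := abs_pos.2 (aeval_int_ne_zero hξ hP.ne_zero)
  -- At `Z` the uniform bound `Z ^ (-v')` equals `|P(ξ)|`. Taking `X = 2 * Z` below makes the value
  -- of `Q` strictly smaller.
  set Z : ℝ := t ^ (-(1 / v')) with hZ
  have hZ0 : 0 < Z := by positivity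
  have hZv : Z ^ (-v') = t := by
    rw [hZ, ← Real.rpow_mul ht0.le]
    have : -(1 / v') * -v' = 1 := by field_simp
    rw [this, Real.rpow_one]
  have hHZ : H ^ (w / v') ≤ Z := by
    have h1 := Real.rpow_le_rpow_of_nonpos ht0 hPv
      (by rw [neg_nonpos]; positivity : -(1 / v') ≤ 0)
    rw [← Real.rpow_mul hH0.le] at h1
    refine le_trans (le_of_eq ?_) h1
    congr 1; field_simp
  have hHZ' : H ≤ Z := by
    refine le_trans ?_ hHZ
    conv_lhs => rw [← Real.rpow_one H]
    exact Real.rpow_le_rpow_of_exponent_le hH1 ((one_le_div hv0).2 hvw)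
  have hb0 : 0 ≤ b := by
    by_contra! hb'
    nlinarith
  have hHZb : H ≤ Z ^ b := by
    have h1 : (H ^ (w / v')) ^ b ≤ Z ^ b := Real.rpow_le_rpow (by positivity) hHZ hb0
    rw [← Real.rpow_mul hH0.le] at h1
    refine le_trans ?_ h1
    conv_lhs => rw [← Real.rpow_one H]
    refine Real.rpow_le_rpow_of_exponent_le hH1 ?_
    rw [div_mul_eq_mul_div, one_le_div hv0]
    linarith
  have hZ2 : Z ≤ 2 * Z := by linarith
  obtain ⟨⟨Q, hQ0, hQd, hQM, hQv⟩, hpX⟩ := hB (2 * Z) (by linarith)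
  have h2v : (2 : ℝ) ^ (-v') < 1 := Real.rpow_lt_one_of_one_lt_of_neg (by norm_num) (by linarith)
  have hXv : (2 * Z) ^ (-v') = 2 ^ (-v') * t := by
    rw [Real.mul_rpow (by norm_num) hZ0.le, hZv]
  have hQlt : |aeval ξ Q| < t := by
    refine hQv.trans_lt ?_
    rw [hXv]
    exact mul_lt_of_lt_one_left ht0 h2v
  refine ⟨2 * Z, Q, hpX, ?_, hQd, hHZ'.trans hZ2, hHZb.trans (Real.rpow_le_rpow hZ0.le hZ2 hb0),
    ?_, hQM, hQlt.le⟩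
  -- As `P` has the full degree `n`, a multiple of degree at most `n` is an integer multiple, and
  -- its value cannot be smaller than that of `P`.
  · rintro ⟨R, rfl⟩
    have hR0 : R ≠ 0 := right_ne_zero_of_mul hQ0
    have hRd : R.natDegree = 0 := by
      rw [natDegree_mul hP.ne_zero hR0] at hQd
      omega
    obtain ⟨z, rfl⟩ := natDegree_eq_zero.1 hRd
    have hz : z ≠ 0 := fun hz => hR0 (by simp [hz])
    rw [map_mul, abs_mul, aeval_C, algebraMap_int_eq, eq_intCast] at hQlt
    have h1 : (1 : ℝ) ≤ |(z : ℝ)| := by exact_mod_cast Int.one_le_abs hz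
    nlinarith
  · rw [hXv, ← mul_assoc, ← Real.rpow_add (by norm_num)]
    simp

theorem coe_le_simExponent_of_isCoprimePair (hξ : Transcendental ℚ ξ) (hC1 : 1 ≤ C)
    (hC : ∀ w ≥ 0, ∀ X ≥ 1, LinSolvable (veronese n ξ) w X → PolySolvable n ξ C w X)
    (hv : uniformLinExponent (veronese n ξ) = (v : EReal)) (hnk : n ≤ k) (hk : k + 2 ≤ 2 * n)
    (hkv : (k : ℝ) < v) :
    (((v + 2 * (n : ℝ) - 2 * (k : ℝ) - 1) /
      ((2 * (n : ℝ) - (k : ℝ) - 2) * v + (k : ℝ)) : ℝ) : EReal) ≤ simExponent (veronese k ξ) := by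
  obtain ⟨r, hr⟩ : ∃ r, k + 1 = n + r := ⟨k + 1 - n, by omega⟩
  have hrR : (k : ℝ) + 1 = n + r := by exact_mod_cast hr
  have hrk : (2 * (r : ℝ)) ≤ k := by exact_mod_cast (by omega : 2 * r ≤ k)
  have hk0 : (0 : ℝ) ≤ k := Nat.cast_nonneg k
  have hden : 0 < ((k : ℝ) - 2 * r) * v + k := by
    have := mul_nonneg (sub_nonneg.2 hrk) (hk0.trans hkv.le)
    have : (0 : ℝ) < k := by exact_mod_cast (by omega : 0 < k)
    linarith
  have e1 : v + 2 * (n : ℝ) - 2 * (k : ℝ) - 1 = v + 1 - 2 * r := by linarith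
  have e2 : 2 * (n : ℝ) - (k : ℝ) - 2 = k - 2 * r := by linarith
  rw [e1, e2]
  refine coe_le_simExponent fun l hl B => ?_
  rw [lt_div_iff₀ hden] at hl
  obtain ⟨v', hv', hkv', hlv'⟩ := exists_lt_of_continuousAt
    (f := fun x => x + 1 - 2 * r - l * (((k : ℝ) - 2 * r) * x + k)) (by fun_prop)
    (by linarith) hkv
  have hv0 : 0 ≤ v' := hk0.trans hkv'.le
  have hU := eventually_polySolvable_of_lt hC hv hv0 hv'
  have hK : 1 ≤ (2 * C) ^ v' := Real.one_le_rpow (by linarith) hv0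
  have hw : (v' : EReal) < linExponent (veronese n ξ) :=
    lt_of_lt_of_le (by rw [hv]; exact EReal.coe_lt_coe_iff.2 hv')
      (uniformLinExponent_le_linExponent _)
  obtain ⟨P, Q, hPQ, -, h1, h2⟩ := exists_isCoprimePair hξ hC1 hC hv0 hU le_rfl hw
    ((eventually_le_of_isCoprimePair n ξ ((2 * C) ^ v') v' (by linarith)).and
      (eventually_simSolvable_of_isCoprimePair (n := n) (ξ := ξ) (v := v') (k := k) (p := r) (q := r) (l := l) hK
        (by omega) (by omega) (by linarith)
        (by
          have : (k : ℝ) - (r + r) = k - 2 * r := by ring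
          rw [this]; linarith) B))
  have hd := h1 P Q hPQ
  -- From `k < v' ≤ n + deg P - 1` and `k + 1 = n + r`; this allows `r` shifts of `Q`.
  have hrd : (r : ℝ) < P.natDegree := by linarith
  have hrd' : r < P.natDegree := by exact_mod_cast hrd
  have := hPQ.natDegree_left_le
  exact h2 P Q hPQ hrd'.le (by omega) (by omega)

/-- The limit ratio of the uniform and the ordinary exponent. -/
theorem exists_ratio_thetaBound_eq {w : EReal} (hvw : (v : EReal) ≤ w) (hv0 : 0 < v) :
    ∃ b : ℝ, 0 ≤ b ∧ b ≤ 1 ∧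
      (∀ b' > b, ∀ v' < v, 0 ≤ v' → ((v' / b' : ℝ) : EReal) < w) ∧
      thetaBound n k w v = (v + ((n : ℝ) - k - 1) + b * (n - k)) /
        ((2 * (n : ℝ) - k - 2) * v + ((k : ℝ) - n + 1) + b * (n - 1)) := by
  by_cases hw : w = ⊤
  · refine ⟨0, le_rfl, zero_le_one, fun b' _ v' _ _ => ?_, ?_⟩
    · rw [hw]; exact EReal.coe_lt_top _
    · simp [thetaBound, hw]
  · have hbot : w ≠ ⊥ := ne_bot_of_le_ne_bot (EReal.coe_ne_bot v) hvw
    obtain ⟨x, rfl⟩ : ∃ x : ℝ, (x : EReal) = w := ⟨w.toReal, EReal.coe_toReal hw hbot⟩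
    have hvx : v ≤ x := EReal.coe_le_coe_iff.1 hvw
    have hx0 : 0 < x := hv0.trans_le hvx
    refine ⟨v / x, by positivity, (div_le_one hx0).2 hvx, fun b' hb' v' hv' h0 => ?_, ?_⟩
    · have hb0 : 0 < b' := (by positivity : 0 < v / x).trans hb'
      rw [EReal.coe_lt_coe_iff, div_lt_iff₀ hb0]
      rw [gt_iff_lt, div_lt_iff₀ hx0] at hb'
      linarith
    · rw [thetaBound, if_neg hw, EReal.toReal_coe]
      -- After division by `x` the bound depends on the ordinary exponent only through `v / x`; the
      -- infinite case is ratio 0.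
      have e1 : x * v + ((n : ℝ) - k - 1) * x + ((n : ℝ) - k) * v =
          x * (v + ((n : ℝ) - k - 1) + v / x * (n - k)) := by field_simp
      have e2 : (2 * (n : ℝ) - k - 2) * (x * v) + ((k : ℝ) - n + 1) * x + ((n : ℝ) - 1) * v =
          x * ((2 * (n : ℝ) - k - 2) * v + ((k : ℝ) - n + 1) + v / x * (n - 1)) := by field_simp
      rw [e1, e2, mul_div_mul_left _ _ hx0.ne']

/-- The degree of `P` is not controlled, so the weaker of two bounds remains: the second entry comes
from `deg P < n`, the first from `deg P = n`. -/
theorem min_thetaBound_le_simExponent (hξ : Transcendental ℚ ξ) (hC1 : 1 ≤ C)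
    (hC : ∀ w ≥ 0, ∀ X ≥ 1, LinSolvable (veronese n ξ) w X → PolySolvable n ξ C w X)
    (hv : uniformLinExponent (veronese n ξ) = (v : EReal)) (hnk : n ≤ k) (hk : k + 3 ≤ 2 * n)
    (hkv : (k : ℝ) < v) :
    ((min (thetaBound n k (linExponent (veronese n ξ)) v)
      ((v + 2 * (n : ℝ) - 2 * (k : ℝ) - 2) /
        ((2 * (n : ℝ) - (k : ℝ) - 3) * v + (k : ℝ))) : ℝ) : EReal)
      ≤ simExponent (veronese k ξ) := by
  obtain ⟨r, hr⟩ : ∃ r, k + 1 = n + r := ⟨k + 1 - n, by omega⟩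
  have hrR : (k : ℝ) + 1 = n + r := by exact_mod_cast hr
  have hrk : (2 * (r : ℝ)) + 1 ≤ k := by exact_mod_cast (by omega : 2 * r + 1 ≤ k)
  have hr1 : (1 : ℝ) ≤ r := by exact_mod_cast (by omega : 1 ≤ r)
  have hn1 : (1 : ℝ) ≤ n := by exact_mod_cast (by omega : 1 ≤ n)
  have hk0 : (0 : ℝ) < k := by exact_mod_cast (by omega : 0 < k)
  have hv0 : 0 < v := hk0.trans hkv
  have hvw : (v : EReal) ≤ linExponent (veronese n ξ) :=
    hv ▸ uniformLinExponent_le_linExponent _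
  obtain ⟨b₀, hb0, hb1, hbw, hΘ⟩ := exists_ratio_thetaBound_eq (n := n) (k := k) hvw hv0
  refine coe_le_simExponent fun l hl B => ?_
  obtain ⟨hl1, hl2⟩ := lt_min_iff.1 hl
  have hden1 : 0 < (2 * (n : ℝ) - k - 2) * v + ((k : ℝ) - n + 1) + b₀ * (n - 1) := by
    have h1 := mul_nonneg (by linarith : (0 : ℝ) ≤ 2 * (n : ℝ) - k - 2) hv0.le
    have h2 := mul_nonneg hb0 (sub_nonneg.2 hn1)
    linarith
  have hden2 : 0 < (2 * (n : ℝ) - (k : ℝ) - 3) * v + (k : ℝ) := by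
    have h1 := mul_nonneg (by linarith : (0 : ℝ) ≤ 2 * (n : ℝ) - k - 3) hv0.le
    linarith
  rw [hΘ, lt_div_iff₀ hden1] at hl1
  rw [lt_div_iff₀ hden2] at hl2
  have hn : (n : ℝ) = k + 1 - r := by linarith
  rw [hn] at hl1 hl2
  -- Since `b₀ ≤ 1`, one has `r + b₀ (r - 1) ≤ 2 r - 1 < k < v`.
  have hβ₀ : 0 < v - r - b₀ * (r - 1) := by nlinarith
  let g : ℝ → ℝ → ℝ := fun b x => x - r - b * (r - 1) -
    l * (((k : ℝ) + 1 - 2 * r) * (r * (1 + b)) + ((k : ℝ) - 2 * r) * (x - r - b * (r - 1)))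
  -- The ratio is moved strictly above `b₀`, so that `v' / b` stays below the ordinary exponent,
  -- which may be infinite (`b₀ = 0`) or not attained.
  obtain ⟨b, hb, hgb, hβb⟩ : ∃ b > b₀, 0 < g b v ∧ 0 < v - r - b * (r - 1) := by
    have h1 : ∀ᶠ b in nhdsWithin b₀ (Set.Ioi b₀), 0 < g b v := by
      have hc : ContinuousAt (fun b => g b v) b₀ := by simp only [g]; fun_prop
      exact nhdsWithin_le_nhds (hc.eventually_const_lt (by simp only [g]; linarith))
    have h2 : ∀ᶠ b in nhdsWithin b₀ (Set.Ioi b₀), 0 < v - r - b * (r - 1) := by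
      have hc : ContinuousAt (fun b : ℝ => v - r - b * ((r : ℝ) - 1)) b₀ := by fun_prop
      exact nhdsWithin_le_nhds (hc.eventually_const_lt hβ₀)
    obtain ⟨b, hb⟩ := (h1.and (h2.and self_mem_nhdsWithin)).exists
    exact ⟨b, hb.2.2, hb.1, hb.2.1⟩
  obtain ⟨v', hv', hkv', hmin⟩ := exists_lt_of_continuousAt
    (f := fun x => min (g b x) (min (x - r - b * (r - 1))
      (x - 2 * r - l * (((k : ℝ) - (2 * r + 1)) * x + k)))) (by simp only [g]; fun_prop)
    (lt_min hgb (lt_min hβb (by linarith))) hkv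
  obtain ⟨hg', hmin'⟩ := lt_min_iff.1 hmin
  obtain ⟨hβ', hl2'⟩ := lt_min_iff.1 hmin'
  have hv0' : 0 < v' := hk0.trans hkv'
  have hbpos : 0 < b := hb0.trans_lt hb
  have hU := eventually_polySolvable_of_lt hC hv hv0'.le hv'
  have hK : 1 ≤ (2 * C) ^ v' := Real.one_le_rpow (by linarith) hv0'.le
  -- The exponent required of `P`: `v' / b` gives the height comparison `X ^ b`, and `v'` is needed
  -- because `b` may exceed 1.
  set w := max (v' / b) v' with hw
  have hww : (w : EReal) < linExponent (veronese n ξ) := by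
    rcases max_choice (v' / b) v' with h | h
    · rw [hw, h]; exact hbw b hb v' hv' hv0'.le
    · rw [hw, h]; exact (EReal.coe_lt_coe_iff.2 hv').trans_le hvw
  have hbvw : v' ≤ b * w := by
    rw [mul_comm, ← div_le_iff₀ hbpos]
    exact le_max_left _ _
  have hθ := eventually_simSolvable_of_natDegree_eq (n := n) (k := k) (r := r) (ξ := ξ) (C := C)
    (v := v') (b := b) (l := l) hC1 (by omega) (by omega) (by omega) (by omega) hbpos.le hβ'
    (by simp only [g] at hg'; linarith) B
  obtain ⟨P, Q, hPQ, hPv, h1, h2, h3⟩ := exists_isCoprimePair hξ hC1 hC hv0'.le hU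
    (le_max_right _ _) hww
    ((eventually_le_of_isCoprimePair n ξ ((2 * C) ^ v') v' (by linarith)).and
      ((eventually_simSolvable_of_isCoprimePair (n := n) (ξ := ξ) (v := v') (k := k) (p := r + 1) (q := r) (l := l) hK
        (by omega) (by omega) (by push_cast; linarith)
        (by
          have : (k : ℝ) - (((r + 1 : ℕ) : ℝ) + r) = k - (2 * r + 1) := by push_cast; ring
          rw [this]; push_cast; linarith) B).and
      (exists_not_dvd_of_natDegree_eq hξ hv0' hU (le_max_right _ _) hbvw hθ)))
  have hd := h1 P Q hPQ
  have hrd : (r : ℝ) < P.natDegree := by linarith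
  have hrd' : r < P.natDegree := by exact_mod_cast hrd
  rcases hPQ.natDegree_left_le.lt_or_eq with hlt | heq
  · exact h2 P Q hPQ hrd'.le (by omega) (by omega)
  · obtain ⟨X, Q', hX, hdvd, hQ'n, hHX, hHb, hPX, hQ'X, hQ'v⟩ :=
      h3 P hPQ.irreducible heq rfl hPv
    exact hX P Q' hPQ.irreducible heq hQ'n hdvd hHX hHb hPX hQ'X hQ'v

end

/-! ### Finiteness of the uniform exponent and assembly of the bounds -/

theorem mainTheorem5 (n k : ℕ) (hn : 2 ≤ n) (hnk : n ≤ k) (ξ : ℝ) (hξ : Transcendental ℚ ξ) :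
    ∃ v : ℝ, uniformLinExponent (veronese n ξ) = (v : EReal) ∧
      (k + 2 ≤ 2 * n →
        (((v + 2 * (n : ℝ) - 2 * (k : ℝ) - 1) /
            ((2 * (n : ℝ) - (k : ℝ) - 2) * v + (k : ℝ)) : ℝ) : EReal)
          ≤ simExponent (veronese k ξ)) ∧
      (k + 3 ≤ 2 * n →
        ((min (thetaBound n k (linExponent (veronese n ξ)) v)
            ((v + 2 * (n : ℝ) - 2 * (k : ℝ) - 2) /
              ((2 * (n : ℝ) - (k : ℝ) - 3) * v + (k : ℝ))) : ℝ) : EReal)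
          ≤ simExponent (veronese k ξ)) := by
  obtain ⟨C, hC1, hC⟩ := exists_polySolvable_of_linSolvable n ξ
  obtain ⟨v, hv0, hv⟩ : ∃ v : ℝ, 0 ≤ v ∧ uniformLinExponent (veronese n ξ) = (v : EReal) := by
    -- An exponent above `2 * n` would give a coprime pair with `2 * n ≤ n + deg P - 1 ≤ 2 * n - 1`.
    refine exists_uniformLinExponent_eq (b := 2 * n) fun w hw hsol => ?_
    have hn' : (0 : ℝ) < n := by exact_mod_cast (by omega : 0 < n)
    by_contra! hlt
    have hU : ∀ᶠ X in atTop, PolySolvable n ξ C (2 * n) X := by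
      filter_upwards [hsol, eventually_ge_atTop 1] with X hX hX1
      exact (hC w hw X hX1 hX).mono hX1 hlt.le
    have hlin : ((2 * n : ℝ) : EReal) < linExponent (veronese n ξ) :=
      (EReal.coe_lt_coe_iff.2 hlt).trans_le
        ((le_sSup ⟨w, hsol, rfl⟩ : (w : EReal) ≤ uniformLinExponent (veronese n ξ)).trans
          (uniformLinExponent_le_linExponent _))
    obtain ⟨P, Q, hPQ, -, h⟩ := exists_isCoprimePair hξ hC1 hC (by positivity) hU le_rfl hlin
      (eventually_le_of_isCoprimePair n ξ ((2 * C) ^ (2 * n : ℝ)) (2 * n) (by positivity))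
    have h1 := h P Q hPQ
    have h2 : (P.natDegree : ℝ) ≤ n := by exact_mod_cast hPQ.natDegree_left_le
    linarith
  have hk0 : (0 : ℝ) < k := by exact_mod_cast (by omega : 0 < k)
  have hnk' : (n : ℝ) ≤ k := by exact_mod_cast hnk
  have hDir := one_div_le_simExponent (by omega : 1 ≤ k) (veronese k ξ)
  refine ⟨v, hv, fun hk => ?_, fun hk => ?_⟩
  · rcases le_or_gt v k with hvk | hkv
    · refine le_trans (EReal.coe_le_coe_iff.2 ?_) hDir
      have hk' : (k : ℝ) + 2 ≤ 2 * n := by exact_mod_cast hk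
      -- Here `m` is the number of forms `2 r`, with `r = k - n + 1`; the second bound uses `2 r +
      -- 1`.
      have h := div_le_one_div_of_le (m := 2 * (k - n + 1)) hk0 (by linarith) hv0 hvk
        (by linarith)
      have e1 : v + 1 - (2 * (k - n + 1)) = v + 2 * (n : ℝ) - 2 * (k : ℝ) - 1 := by ring
      have e2 : (k : ℝ) - (2 * (k - n + 1)) = 2 * (n : ℝ) - (k : ℝ) - 2 := by ring
      rwa [e1, e2] at h
    · exact coe_le_simExponent_of_isCoprimePair hξ hC1 hC hv hnk hk hkv
  · rcases le_or_gt v k with hvk | hkv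
    · refine le_trans (EReal.coe_le_coe_iff.2 ((min_le_right _ _).trans ?_)) hDir
      have hk' : (k : ℝ) + 3 ≤ 2 * n := by exact_mod_cast hk
      have h := div_le_one_div_of_le (m := 2 * (k - n + 1) + 1) hk0 (by linarith) hv0 hvk
        (by linarith)
      have e1 : v + 1 - (2 * (k - n + 1) + 1) = v + 2 * (n : ℝ) - 2 * (k : ℝ) - 2 := by ring
      have e2 : (k : ℝ) - (2 * (k - n + 1) + 1) = 2 * (n : ℝ) - (k : ℝ) - 3 := by ring
      rwa [e1, e2] at h
    · exact min_thetaBound_le_simExponent hξ hC1 hC hv hnk hk hkv
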